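/- Let $M,\alpha\in\mathbb R$ satisfy $\frac13(M+2)<\alpha\le\frac25(M-10)$, and write $a_{(j)}=aM^{-j}$. *Cantor measure.* Let $I_{0,0}=[0,1]$ and, if $I_{k,l}=[x_1,x_2]$ ($0\le l<2^k$), let $I_{k+1,2l}=[x_1,x_1+\frac{x_2-x_1}{M}]$ and $I_{k+1,2l+1}=[x_2-\frac{x_2-x_1}{M},x_2]$. Put $S_k=\bigcup_{l=0}^{2^k-1}I_{k,l}$, $S=\bigcap_{k\ge0}S_k$ and $\rho_k=(M/2)^k\sum_{l=0}^{2^k-1}\chi_{I_{k,l}}$, which is a probability density. Let $\rho_\infty$ be the weak limit of $\rho_k$ as $k\to\infty$, i.e. the uniform distribution on the Cantor set $S$. *Potential.* For $k\ge1$ let $W_k'$ be the odd function given for $x>0$ by $W_k'(x)=\frac{M}{2M-4}(-1+2x)+\omega_k(x)$, where $$\omega_k(x)=\begin{cases}0,&0<x\le(M-\alpha)_{(k)},\\ \left(-\frac32+\frac34\cdot\frac{2}{\alpha-2}(M-2)\right)-\frac34\cdot\frac2{\alpha-2}M^kx,&(M-\alpha)_{(k)}\le x\le(M-2)_{(k)},\\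 -(M-\frac12)+M^jx,&(M-2)_{(j)}\le x\le M_{(j)},\ j=1,\dots,k,\\ \frac12,&1_{(j)}\le x\le(M-\alpha)_{(j)},\ j=1,\dots,k-1,\\ \left(-\frac32+\frac2{\alpha-2}(M-2)\right)-\frac2{\alpha-2}M^jx,&(M-\alpha)_{(j)}\le x\le(M-2)_{(j)},\ j=1,\dots,k-1,\\ \frac12,&x\ge1.\end{cases}$$ Let $W_\infty$ be the continuous function on $\mathbb R$, unique up to an additive constant (which may be chosen arbitrarily), whose derivative is $W_\infty'(x)=\lim_{k\to\infty}W_k'(x)$ for all $x\ne0$. Then the limits defining $W_\infty'$ and $\rho_\infty$ exist, $\operatorname{supp}\rho_\infty=S$, the convolution $W_\infty*\rho_\infty$ is well defined everywhere, and: 1. There is a constant $c_\infty$ with $(W_\infty*\rho_\infty)(x)=c_\infty$ for all $x\in\operatorname{supp}\rho_\infty$ and $(W_\infty*\rho_\infty)(x)>c_\infty$ for all $x\notin\operatorname{supp}\rho_\infty$. 2. $W_\infty*\rho_\infty\in C^{1,\gamma}_{loc}(\mathbb R)$ for some $\gamma\in(0,1]$, that is, it is $C^1$ and its derivative is $\gamma$-Hölder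 continuous on every compact set. 3. Therefore $W_\infty'*\rho_\infty$ is defined pointwise (the integral $\int W_\infty'(x-y)\,d\rho_\infty(y)$ converges absolutely for every $x$) and equals the derivative of $W_\infty*\rho_\infty$, and $W_\infty'*\rho_\infty=0$ on $\operatorname{supp}\rho_\infty$; that is, $\rho_\infty$ is a steady state of the interaction energy $E[\rho]=\frac12\iint W_\infty(x-y)\,d\rho(y)\,d\rho(x)$: $0$ belongs to the (Fréchet) subdifferential of $W_\infty*\rho_\infty$ at $\rho_\infty$-a.e. point. 4. $\rho_\infty$ satisfies the necessary condition for $d_2$-local minimizers (local minimizers of $E$ for the $2$-Wasserstein distance): $W_\infty*\rho_\infty=2E[\rho_\infty]$ $\rho_\infty$-a.e. and $W_\infty*\rho_\infty\ge2E[\rho_\infty]$ Lebesgue-a.e. on $\mathbb R$. -/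

import Mathlib

open MeasureTheory Filter Topology
open scoped NNReal ENNReal BoundedContinuousFunction

namespace CantorSteady

noncomputable section

/-! ### The Cantor set, its approximations and the uniform measure -/

/-- The pair (left endpoint, right endpoint) of the interval `I_{k,l}`, `0 ≤ l < 2 ^ k`:
`I_{0,0} = [0,1]`, and `I_{k+1,2l}`, `I_{k+1,2l+1}` are the left and the right subinterval of
`I_{k,l}` of relative length `1 / M`. -/
def endpoints (M : ℝ) : ℕ → ℕ → ℝ × ℝ
  | 0, _ => (0, 1)
  | k + 1, l =>
    if l % 2 = 0 then
      ((endpoints M k (l / 2)).1,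
        (endpoints M k (l / 2)).1 + ((endpoints M k (l / 2)).2 - (endpoints M k (l / 2)).1) / M)
    else
      ((endpoints M k (l / 2)).2 - ((endpoints M k (l / 2)).2 - (endpoints M k (l / 2)).1) / M,
        (endpoints M k (l / 2)).2)

/-- The closed interval `I_{k,l}`. -/
def interval (M : ℝ) (k l : ℕ) : Set ℝ :=
  Set.Icc (endpoints M k l).1 (endpoints M k l).2

/-- `S_k = ⋃_{l < 2^k} I_{k,l}`. -/
def level (M : ℝ) (k : ℕ) : Set ℝ := ⋃ l ∈ Finset.range (2 ^ k), interval M k l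

/-- The Cantor set `S = ⋂_k S_k`. -/
def cantorSet (M : ℝ) : Set ℝ := ⋂ k : ℕ, level M k

/-- The density `ρ_k = (M/2)^k ∑_{l < 2^k} χ_{I_{k,l}}`. -/
def rhoDensity (M : ℝ) (k : ℕ) (x : ℝ) : ℝ :=
  (M / 2) ^ k * ∑ l ∈ Finset.range (2 ^ k), (interval M k l).indicator (fun _ => (1 : ℝ)) x

/-- The measure `ρ_k(x) dx`. -/
def rhoMeasure (M : ℝ) (k : ℕ) : Measure ℝ :=
  volume.withDensity (fun x => ENNReal.ofReal (rhoDensity M k x))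

/-- Weak convergence of the finite measures `μ k` to the finite measure `ν`, tested against bounded
continuous functions. -/
def WeakLimit (μ : ℕ → Measure ℝ) (ν : Measure ℝ) : Prop :=
  ∀ f : ℝ →ᵇ ℝ, Tendsto (fun k => ∫ x, f x ∂(μ k)) atTop (𝓝 (∫ x, f x ∂ν))

/-! ### The potentials -/

/-- `a_{(j)} = a M^{-j}`. -/
def sc (M a : ℝ) (j : ℕ) : ℝ := a / M ^ j

/-- The continuous piecewise linear function `ω_k` on `(0, ∞)`, for `k ≥ 1`. It vanishes on
`(0, (M-α)_{(k)}]`, and the terms below are its other pieces. The half-open intervals are disjoint;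
at their common endpoints the formulas of neighbouring pieces agree. -/
def omegaPos (M α : ℝ) (k : ℕ) (x : ℝ) : ℝ :=
  (Set.Ioc (sc M (M - α) k) (sc M (M - 2) k)).indicator
      (fun x => (-(3 / 2) + 3 / 4 * (2 / (α - 2)) * (M - 2))
        - 3 / 4 * (2 / (α - 2)) * M ^ k * x) x
  + ∑ j ∈ Finset.Icc 1 k, (Set.Ioc (sc M (M - 2) j) (sc M M j)).indicator
      (fun x => -(M - 1 / 2) + M ^ j * x) x
  + ∑ j ∈ Finset.Ico 1 k, (Set.Ioc (sc M 1 j) (sc M (M - α) j)).indicator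
      (fun _ => 1 / 2) x
  + ∑ j ∈ Finset.Ico 1 k, (Set.Ioc (sc M (M - α) j) (sc M (M - 2) j)).indicator
      (fun x => (-(3 / 2) + 2 / (α - 2) * (M - 2)) - 2 / (α - 2) * M ^ j * x) x
  + (Set.Ioi (1 : ℝ)).indicator (fun _ => 1 / 2) x

/-- The odd function `W_k'`, equal to `M / (2M - 4) * (-1 + 2x) + ω_k(x)` for `x > 0`
(and to `0` at `x = 0`). -/
def derivPotential (M α : ℝ) (k : ℕ) (x : ℝ) : ℝ :=
  M / (2 * M - 4) * (-Real.sign x + 2 * x) + Real.sign x * omegaPos M α k |x|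

/-- `W_∞'(x) = lim_{k → ∞} W_k'(x)`. -/
def limitDeriv (M α x : ℝ) : ℝ := limUnder atTop (fun k : ℕ => derivPotential M α k x)

/-- The potential `W_∞` with derivative `W_∞'` and value `c₀` at the origin. -/
def limitPotential (M α c₀ x : ℝ) : ℝ := c₀ + ∫ t in (0 : ℝ)..x, limitDeriv M α t

/-! ### Interaction energy, steady states and regularity -/

/-- `(W * ρ)(x) = ∫ W(x - y) dρ(y)`. -/
def conv (W : ℝ → ℝ) (ρ : Measure ℝ) (x : ℝ) : ℝ := ∫ y, W (x - y) ∂ρ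

/-- The interaction energy `E[ρ] = (1/2) ∬ W(x - y) dρ(y) dρ(x)`. -/
def energy (W : ℝ → ℝ) (ρ : Measure ℝ) : ℝ := 1 / 2 * ∫ x, ∫ y, W (x - y) ∂ρ ∂ρ

/-- The (Fréchet) subdifferential of `V : ℝ → ℝ` at `x`: the set of `p` such that
`V y ≥ V x + p (y - x) + o(|y - x|)` as `y → x`. -/
def subdifferential (V : ℝ → ℝ) (x : ℝ) : Set ℝ :=
  {p | ∀ ε > 0, ∀ᶠ y in 𝓝 x, V x + p * (y - x) - ε * |y - x| ≤ V y}

/-- `ρ` is a steady state of the interaction energy with potential `W`: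
`0 ∈ ∂(W * ρ)(x)` for `ρ`-almost every `x`. -/
def IsSteadyState (W : ℝ → ℝ) (ρ : Measure ℝ) : Prop :=
  ∀ᵐ x ∂ρ, (0 : ℝ) ∈ subdifferential (conv W ρ) x

/-- The (necessary) condition for `d₂`-local minimizers: with `V = W * ρ`, `V = 2 E[ρ]` holds
`ρ`-almost everywhere and `V ≥ 2 E[ρ]` holds Lebesgue-almost everywhere. -/
def D2MinimizerCondition (W : ℝ → ℝ) (ρ : Measure ℝ) : Prop :=
  (∀ᵐ x ∂ρ, conv W ρ x = 2 * energy W ρ) ∧ (∀ᵐ x, 2 * energy W ρ ≤ conv W ρ x)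

/-- `f ∈ C^{1,γ}_loc(ℝ)`: `f` is `C¹` and `f'` is `γ`-Hölder continuous on every compact set. -/
def C1HolderLoc (γ : ℝ≥0) (f : ℝ → ℝ) : Prop :=
  ContDiff ℝ 1 f ∧ ∀ K : Set ℝ, IsCompact K → ∃ C : ℝ≥0, HolderOnWith C γ (deriv f) K

end

end CantorSteady

/-! Everything is self-similar under the contractions y/M and (y + M - 1)/M. In the limit, W_∞' on x
> 0 is -1/(M-2) + Mx/(M-2) minus `hatSum`, a sum of copies of one tent `hat` at the scales M^(-j),
so that `hatSum` at x is `hat` plus `hatSum` at Mx (`hatSum_rec`). The measure ρ_∞ is the only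
probability measure on [0,1] fixed by `branch`; it is realised as the law of a random series in
binary digits. The ρ_k are the iterates of `branch` on Lebesgue measure, hence converge to it.

Let V = W_∞ * ρ_∞ and F = V'. The coefficient 1/(M-2) and the falling side of slope -1 of the tent
are tuned so that F(x) = F(Mx)/2 on (0, 1/M) (`force_self_similar`). Hence V(x) - V(0) = (V(Mx) -
V(0))/(2M) on the left first-level interval, and likewise on the right one by reflection. Iterating
this for the bounded function V - V(0) gives V = V(0) on S (`potential_on_cantorSet`). A point off S
is carried by finitely many expansions into the middle gap or out of [0,1], and each expansion
multiplies V - V(0) by a positive constant; so strictness is needed only there (`potential_gap`,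
`potential_gt_one`).

F becomes negative inside the gap, so both inequalities are integrated ones. The upper bound on α
makes the primitive of the averaged tents to the right of 1 at most s/2 (`tailPrimitive_le`). The
lower bound on α makes the gain in V over the wide side of the tent outweigh the loss on the way to
the midpoint of the gap.

For regularity, an interval of length M^(-n) has mass at most 2^(-n) (`real_Icc_le`), while W_∞'
minus its linear part is bounded, with Lipschitz constant O(M^n) at distance M^(-n) from 0.
Splitting the convolution at that distance gives the Hölder exponent log 2 / (2 log M). Absence of
atoms makes the discontinuity of W_∞' at 0 harmless when differentiating V. Steady state, zero force
and the minimizer condition then follow from V being minimal on S. -/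

namespace CantorSteady

noncomputable section

/-- The range of parameters for which the construction works. -/
structure Admissible (M α : ℝ) : Prop where
  lower : 1 / 3 * (M + 2) < α
  upper : α ≤ 2 / 5 * (M - 10)

/-! ### Numerical consequences of the two bounds on α. -/

namespace Admissible

variable {M α : ℝ}

theorem lt_M (h : Admissible M α) : 70 < M := by
  have := h.lower; have := h.upper; linarith

theorem lt_alpha (h : Admissible M α) : 24 < α := by
  have := h.lower; have := h.lt_M; linarith

theorem M_pos (h : Admissible M α) : 0 < M := by linarith [h.lt_M]

theorem slope_pos (h : Admissible M α) : 0 < 2 / (α - 2) := by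
  have := h.lt_alpha
  apply div_pos <;> linarith

theorem slope_lt (h : Admissible M α) : 2 / (α - 2) < 1 / 11 := by
  have := h.lt_alpha
  rw [div_lt_div_iff₀] <;> linarith

theorem slope_mul (h : Admissible M α) : 2 / (α - 2) * (α - 2) = 2 :=
  div_mul_cancel₀ _ (by linarith [h.lt_alpha])

theorem exists_one_le_pow_mul (h : Admissible M α) {x : ℝ} (hx : 0 < x) :
    ∃ n : ℕ, 1 ≤ M ^ n * x := by
  obtain ⟨n, hn⟩ := pow_unbounded_of_one_lt (1 / x) (by linarith [h.lt_M] : (1 : ℝ) < M)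
  exact ⟨n, ((div_lt_iff₀ hx).1 hn).le⟩

end Admissible

/-! ### The tent function and the sum of its rescalings -/

/-- The tent with base `[M - α, M]` and peak `2` at `M - 2`. -/
def hat (M α t : ℝ) : ℝ := max 0 (min (2 / (α - 2) * (t - (M - α))) (M - t))

/-- The sum of the rescaled tents. -/
def hatSum (M α x : ℝ) : ℝ := ∑' j : ℕ, hat M α (M ^ (j + 1) * x)

variable {M α : ℝ}

theorem continuous_hat : Continuous (hat M α) := by
  unfold hat; fun_prop

theorem hat_nonneg (t : ℝ) : 0 ≤ hat M α t := le_max_left _ _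

theorem hat_eq_zero_of_le (h : Admissible M α) {t : ℝ} (ht : t ≤ M - α) : hat M α t = 0 := by
  apply max_eq_left
  apply (min_le_left _ _).trans
  apply mul_nonpos_of_nonneg_of_nonpos h.slope_pos.le
  linarith

theorem hat_eq_zero_of_ge {t : ℝ} (ht : M ≤ t) : hat M α t = 0 :=
  max_eq_left ((min_le_right _ _).trans (by linarith))

theorem hat_le_two (h : Admissible M α) (t : ℝ) : hat M α t ≤ 2 := by
  apply max_le (by norm_num)
  rcases le_total t (M - 2) with ht | ht
  · refine (min_le_left _ _).trans (le_of_le_of_eq ?_ h.slope_mul)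
    apply mul_le_mul_of_nonneg_left _ h.slope_pos.le
    linarith
  · exact (min_le_right _ _).trans (by linarith)

theorem hat_of_rising (h : Admissible M α) {t : ℝ} (h1 : M - α ≤ t) (h2 : t ≤ M - 2) :
    hat M α t = 2 / (α - 2) * (t - (M - α)) := by
  have h3 : 2 / (α - 2) * (t - (M - α)) ≤ 2 / (α - 2) * (α - 2) :=
    mul_le_mul_of_nonneg_left (by linarith) h.slope_pos.le
  rw [h.slope_mul] at h3
  unfold hat
  rw [min_eq_left (by linarith), max_eq_right]
  exact mul_nonneg h.slope_pos.le (by linarith)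

theorem hat_of_falling (h : Admissible M α) {t : ℝ} (h1 : M - 2 ≤ t) (h2 : t ≤ M) :
    hat M α t = M - t := by
  have h3 : 2 / (α - 2) * (α - 2) ≤ 2 / (α - 2) * (t - (M - α)) :=
    mul_le_mul_of_nonneg_left (by linarith) h.slope_pos.le
  rw [h.slope_mul] at h3
  unfold hat
  rw [min_eq_right (by linarith), max_eq_right (by linarith)]

theorem abs_hat_sub_le (h : Admissible M α) (a b : ℝ) :
    |hat M α a - hat M α b| ≤ |a - b| := by
  unfold hat
  refine (abs_max_sub_max_le_max _ _ _ _).trans (max_le (by simp) ?_)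
  refine (abs_min_sub_min_le_max _ _ _ _).trans (max_le ?_ ?_)
  · rw [← mul_sub, abs_mul, abs_of_pos h.slope_pos, sub_sub_sub_cancel_right]
    have := h.slope_lt
    have := abs_nonneg (a - b)
    nlinarith
  · rw [sub_sub_sub_cancel_left, abs_sub_comm]

theorem hatSum_of_nonpos (h : Admissible M α) {x : ℝ} (hx : x ≤ 0) : hatSum M α x = 0 := by
  unfold hatSum
  rw [← tsum_zero (α := ℝ) (β := ℕ)]
  congr 1
  ext j
  apply hat_eq_zero_of_le h
  have : M ^ (j + 1) * x ≤ 0 :=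
    mul_nonpos_of_nonneg_of_nonpos (pow_nonneg h.M_pos.le _) hx
  linarith [h.lt_M, h.upper]

theorem hatSum_eq_sum (h : Admissible M α) {x : ℝ} {n : ℕ} (hx : 1 ≤ M ^ n * x) :
    hatSum M α x = ∑ j ∈ Finset.range n, hat M α (M ^ (j + 1) * x) := by
  refine tsum_eq_sum fun j hj => hat_eq_zero_of_ge ?_
  rw [Finset.mem_range, not_lt] at hj
  have hM := h.M_pos
  have hx0 : 0 < x := by
    by_contra! hx0
    linarith [mul_nonpos_of_nonneg_of_nonpos (pow_nonneg hM.le n) hx0]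
  have h1 : M ^ n ≤ M ^ j := pow_le_pow_right₀ (by linarith [h.lt_M]) hj
  calc M ≤ M * (M ^ n * x) := le_mul_of_one_le_right hM.le hx
    _ ≤ M * (M ^ j * x) := by gcongr
    _ = M ^ (j + 1) * x := by ring

/-- An index shift. Together with the scale invariance of the sign, this is how the self-similarity
of the kernel enters all later recursions. -/
theorem hatSum_rec (h : Admissible M α) (x : ℝ) :
    hatSum M α x = hat M α (M * x) + hatSum M α (M * x) := by
  rcases le_or_gt x 0 with hx | hx
  · have hMx : M * x ≤ 0 := mul_nonpos_of_nonneg_of_nonpos h.M_pos.le hx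
    rw [hatSum_of_nonpos h hx, hatSum_of_nonpos h hMx, hat_eq_zero_of_le h, add_zero]
    linarith [h.lt_M, h.upper]
  · obtain ⟨n, hn⟩ := h.exists_one_le_pow_mul (mul_pos h.M_pos hx)
    rw [hatSum_eq_sum h hn, hatSum_eq_sum h (n := n + 1) (by rw [pow_succ, mul_assoc]; exact hn),
      Finset.sum_range_succ', zero_add, pow_one, add_comm]
    congr 1
    refine Finset.sum_congr rfl fun j _ => ?_
    rw [pow_succ M (j + 1), mul_assoc]

theorem hatSum_of_one_le (h : Admissible M α) {x : ℝ} (hx : 1 ≤ x) : hatSum M α x = 0 := by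
  rw [hatSum_eq_sum h (n := 0) (by simpa using hx), Finset.sum_range_zero]

theorem hatSum_nonneg (x : ℝ) : 0 ≤ hatSum M α x := tsum_nonneg fun _ => hat_nonneg _

theorem hatSum_le_two (h : Admissible M α) (x : ℝ) : hatSum M α x ≤ 2 := by
  rcases le_or_gt x 0 with hx | hx
  · rw [hatSum_of_nonpos h hx]; norm_num
  obtain ⟨n, hn⟩ := h.exists_one_le_pow_mul hx
  clear hx
  induction n generalizing x with
  | zero => rw [hatSum_of_one_le h (by simpa using hn)]; norm_num
  | succ n ih =>
    rw [hatSum_rec h]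
    -- Different scales do not overlap: `hatSum` at Mx needs Mx < 1, while `hat` at Mx needs Mx > M
    -- - α > 1.
    rcases le_or_gt 1 (M * x) with h1 | h1
    · rw [hatSum_of_one_le h h1, add_zero]; exact hat_le_two h _
    · rw [hat_eq_zero_of_le h, zero_add]
      · exact ih _ (by rwa [← mul_assoc, ← pow_succ])
      · linarith [h.lt_M, h.upper]

theorem abs_hatSum_sub_le (h : Admissible M α) (n : ℕ) {a b : ℝ} (ha : 1 ≤ M ^ n * a)
    (hb : 1 ≤ M ^ n * b) : |hatSum M α a - hatSum M α b| ≤ 2 * M ^ n * |a - b| := by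
  -- The constant is strengthened to close the induction: M(2M^n - 2) + M ≤ 2M^(n+1) - 2 because M ≥
  -- 2.
  suffices H : |hatSum M α a - hatSum M α b| ≤ (2 * M ^ n - 2) * |a - b| by
    linarith [abs_nonneg (a - b)]
  induction n generalizing a b with
  | zero =>
    rw [hatSum_of_one_le h (by simpa using ha), hatSum_of_one_le h (by simpa using hb)]
    simp
  | succ n ih =>
    rw [pow_succ, mul_assoc] at ha hb
    rw [hatSum_rec h a, hatSum_rec h b, add_sub_add_comm]
    have h1 := abs_hat_sub_le h (M * a) (M * b)
    have h2 := ih ha hb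
    rw [← mul_sub, abs_mul, abs_of_pos h.M_pos] at h1 h2
    have h3 := abs_add_le (hat M α (M * a) - hat M α (M * b))
      (hatSum M α (M * a) - hatSum M α (M * b))
    have h4 := mul_nonneg (by linarith [h.lt_M] : 0 ≤ M - 2) (abs_nonneg (a - b))
    rw [pow_succ]
    nlinarith

theorem tendsto_sum_hat (h : Admissible M α) (x : ℝ) :
    Tendsto (fun n => ∑ j ∈ Finset.range n, hat M α (M ^ (j + 1) * x)) atTop
      (𝓝 (hatSum M α x)) := by
  rcases le_or_gt x 0 with hx | hx
  · rw [hatSum_of_nonpos h hx]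
    refine tendsto_const_nhds.congr fun n => (Finset.sum_eq_zero fun j _ => ?_).symm
    apply hat_eq_zero_of_le h
    have : M ^ (j + 1) * x ≤ 0 :=
      mul_nonpos_of_nonneg_of_nonpos (pow_nonneg h.M_pos.le _) hx
    linarith [h.lt_M, h.upper]
  · obtain ⟨n, hn⟩ := h.exists_one_le_pow_mul hx
    refine tendsto_const_nhds.congr' ?_
    filter_upwards [eventually_ge_atTop n] with m hm
    apply hatSum_eq_sum h
    refine hn.trans ?_
    gcongr
    linarith [h.lt_M]

theorem measurable_hatSum (h : Admissible M α) : Measurable (hatSum M α) := by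
  refine measurable_of_tendsto_metrizable (f := fun n x =>
    ∑ j ∈ Finset.range n, hat M α (M ^ (j + 1) * x)) (fun n => ?_)
    (tendsto_pi_nhds.2 fun x => tendsto_sum_hat h x)
  have := continuous_hat (M := M) (α := α)
  exact Continuous.measurable (by fun_prop)

/-! ### The limit of the derivatives of the potentials -/

theorem mem_Ioc_sc (h : Admissible M α) {a b x : ℝ} {j : ℕ} :
    x ∈ Set.Ioc (sc M a j) (sc M b j) ↔ a < M ^ j * x ∧ M ^ j * x ≤ b := by
  have : 0 < M ^ j := pow_pos h.M_pos j
  rw [Set.mem_Ioc, sc, sc, div_lt_iff₀' this, le_div_iff₀' this]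

/-- The three pieces of ω_k at one scale are a plateau of height 1/2 with a tent cut out of it. -/
theorem omegaPos_piece (h : Admissible M α) (j : ℕ) (x : ℝ) :
    (Set.Ioc (sc M (M - 2) j) (sc M M j)).indicator (fun x => -(M - 1 / 2) + M ^ j * x) x
    + (Set.Ioc (sc M 1 j) (sc M (M - α) j)).indicator (fun _ => (1 / 2 : ℝ)) x
    + (Set.Ioc (sc M (M - α) j) (sc M (M - 2) j)).indicator
      (fun x => (-(3 / 2) + 2 / (α - 2) * (M - 2)) - 2 / (α - 2) * M ^ j * x) x
    = (Set.Ioc (sc M 1 j) (sc M M j)).indicator (fun _ => (1 / 2 : ℝ)) x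
      - hat M α (M ^ j * x) := by
  classical
  simp only [Set.indicator_apply, mem_Ioc_sc h]
  set t := M ^ j * x with ht
  have hM := h.lt_M
  have hα := h.lt_alpha
  have hu := h.upper
  rcases le_or_gt t 1 with h1 | h1
  · rw [if_neg (by rintro ⟨_, _⟩; linarith), if_neg (by rintro ⟨_, _⟩; linarith),
      if_neg (by rintro ⟨_, _⟩; linarith), if_neg (by rintro ⟨_, _⟩; linarith),
      hat_eq_zero_of_le h (by linarith)]
    norm_num
  rcases le_or_gt t (M - α) with h2 | h2
  · rw [if_neg (by rintro ⟨_, _⟩; linarith), if_pos ⟨h1, h2⟩,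
      if_neg (by rintro ⟨_, _⟩; linarith), if_pos ⟨h1, by linarith⟩,
      hat_eq_zero_of_le h (by linarith)]
    norm_num
  rcases le_or_gt t (M - 2) with h3 | h3
  · rw [if_neg (by rintro ⟨_, _⟩; linarith), if_neg (by rintro ⟨_, _⟩; linarith),
      if_pos ⟨h2, h3⟩, if_pos ⟨h1, by linarith⟩, hat_of_rising h h2.le h3, mul_assoc, ← ht]
    have := h.slope_mul
    linear_combination this
  rcases le_or_gt t M with h4 | h4
  · rw [if_pos ⟨h3, h4⟩, if_neg (by rintro ⟨_, _⟩; linarith),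
      if_neg (by rintro ⟨_, _⟩; linarith), if_pos ⟨h1, h4⟩, hat_of_falling h h3.le h4]
    ring
  · rw [if_neg (by rintro ⟨_, _⟩; linarith), if_neg (by rintro ⟨_, _⟩; linarith),
      if_neg (by rintro ⟨_, _⟩; linarith), if_neg (by rintro ⟨_, _⟩; linarith),
      hat_eq_zero_of_ge h4.le]
    norm_num

/-- The plateaus tile a half-line, since M_(j+1) = 1_(j). -/
theorem sum_indicator_scales (h : Admissible M α) (k : ℕ) (x : ℝ) :
    ∑ j ∈ Finset.Ico 1 (k + 1),
        (Set.Ioc (sc M 1 j) (sc M M j)).indicator (fun _ => (1 / 2 : ℝ)) x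
      + (Set.Ioi (1 : ℝ)).indicator (fun _ => 1 / 2) x
    = (Set.Ioi (sc M 1 k)).indicator (fun _ => (1 / 2 : ℝ)) x := by
  induction k with
  | zero => simp [sc]
  | succ k ih =>
    rw [Finset.sum_Ico_succ_top (by omega), add_right_comm, ih]
    have hs : sc M M (k + 1) = sc M 1 k := by
      have := h.M_pos.ne'
      unfold sc
      field_simp
      ring
    have hlt : sc M 1 (k + 1) < sc M 1 k := by
      unfold sc
      exact one_div_lt_one_div_of_lt (pow_pos h.M_pos k)
        (pow_lt_pow_right₀ (by linarith [h.lt_M]) (by omega))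
    rw [hs, add_comm, ← Set.Ioc_union_Ioi_eq_Ioi hlt.le,
      Set.indicator_union_of_disjoint (Set.Ioc_disjoint_Ioi le_rfl)]

/-- The modified pieces of finest index k + 1, with the factor 3/4, live below 1_(k) and are not
seen from x. They therefore leave no trace in the limit. -/
theorem omegaPos_eq (h : Admissible M α) {k : ℕ} {x : ℝ} (hx : sc M 1 k < x) :
    omegaPos M α (k + 1) x
      = 1 / 2 - ∑ j ∈ Finset.range k, hat M α (M ^ (j + 1) * x) := by
  have hk : 0 < M ^ (k + 1) := pow_pos h.M_pos _
  have hx' : M < M ^ (k + 1) * x := by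
    have := (div_lt_iff₀' (pow_pos h.M_pos k)).1 hx
    rw [pow_succ', mul_assoc]
    exact lt_mul_of_one_lt_right h.M_pos this
  have h1 : x ∉ Set.Ioc (sc M (M - α) (k + 1)) (sc M (M - 2) (k + 1)) := by
    rw [mem_Ioc_sc h]; rintro ⟨_, _⟩; linarith
  have h2 : x ∉ Set.Ioc (sc M (M - 2) (k + 1)) (sc M M (k + 1)) := by
    rw [mem_Ioc_sc h]; rintro ⟨_, _⟩; linarith
  have hIcc : Finset.Icc 1 (k + 1) = insert (k + 1) (Finset.Ico 1 (k + 1)) := by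
    ext j; simp only [Finset.mem_Icc, Finset.mem_insert, Finset.mem_Ico]; omega
  have h3 := sum_indicator_scales h k x
  rw [Set.indicator_of_mem (show x ∈ Set.Ioi (sc M 1 k) from hx)] at h3
  have h4 := Finset.sum_congr (rfl : Finset.Ico 1 (k + 1) = _) fun j _ => omegaPos_piece h j x
  rw [Finset.sum_sub_distrib, Finset.sum_add_distrib, Finset.sum_add_distrib] at h4
  have h5 : ∑ j ∈ Finset.Ico 1 (k + 1), hat M α (M ^ j * x)
      = ∑ j ∈ Finset.range k, hat M α (M ^ (j + 1) * x) := by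
    rw [Finset.sum_Ico_eq_sum_range]
    exact Finset.sum_congr (by simp) fun j _ => by rw [add_comm 1 j]
  unfold omegaPos
  rw [Set.indicator_of_notMem h1, hIcc, Finset.sum_insert (by simp), Set.indicator_of_notMem h2]
  linarith

/-- An explicit form of the derivative of the limit potential. -/
def kernel (M α x : ℝ) : ℝ :=
  -(1 / (M - 2)) * Real.sign x + M / (M - 2) * x - hatSum M α x + hatSum M α (-x)

theorem tendsto_omegaPos (h : Admissible M α) {x : ℝ} (hx : 0 < x) :
    Tendsto (fun k => omegaPos M α k x) atTop (𝓝 (1 / 2 - hatSum M α x)) := by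
  rw [← tendsto_add_atTop_iff_nat 1]
  refine ((tendsto_sum_hat h x).const_sub (1 / 2)).congr' ?_
  obtain ⟨n, hn⟩ := h.exists_one_le_pow_mul hx
  filter_upwards [eventually_gt_atTop n] with k hk
  refine (omegaPos_eq h ?_).symm
  rw [sc, div_lt_iff₀' (pow_pos h.M_pos k)]
  refine hn.trans_lt ?_
  gcongr
  linarith [h.lt_M]

theorem tendsto_derivPotential (h : Admissible M α) (x : ℝ) :
    Tendsto (fun k : ℕ => derivPotential M α k x) atTop (𝓝 (kernel M α x)) := by
  have hM : M - 2 ≠ 0 := by linarith [h.lt_M]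
  have hM' : M / (2 * M - 4) = M / (M - 2) / 2 := by
    rw [div_div]; congr 1; ring
  unfold derivPotential kernel
  rw [hM']
  rcases lt_trichotomy x 0 with hx | rfl | hx
  · rw [Real.sign_of_neg hx, abs_of_neg hx, hatSum_of_nonpos h hx.le]
    convert ((tendsto_omegaPos h (neg_pos.2 hx)).const_mul (-1)).const_add _ using 2
    field_simp
    ring
  · simp
  · rw [Real.sign_of_pos hx, abs_of_pos hx, hatSum_of_nonpos h (neg_nonpos.2 hx.le)]
    convert ((tendsto_omegaPos h hx).const_mul 1).const_add _ using 2
    field_simp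
    ring

theorem limitDeriv_eq (h : Admissible M α) : limitDeriv M α = kernel M α :=
  funext fun x => (tendsto_derivPotential h x).limUnder_eq

/-! ### Measures generated by two contractions -/

/-- The contraction of `[0, 1]` onto its left subinterval. -/
def leftMap (M y : ℝ) : ℝ := y / M

/-- The contraction of `[0, 1]` onto its right subinterval. -/
def rightMap (M y : ℝ) : ℝ := (y + (M - 1)) / M

theorem continuous_leftMap : Continuous (leftMap M) := by unfold leftMap; fun_prop

theorem continuous_rightMap : Continuous (rightMap M) := by unfold rightMap; fun_prop

/-- The average of the images of a measure under the two contractions. -/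
def branch (M : ℝ) (μ : Measure ℝ) : Measure ℝ :=
  (2⁻¹ : ℝ≥0∞) • μ.map (leftMap M) + (2⁻¹ : ℝ≥0∞) • μ.map (rightMap M)

theorem branch_apply (μ : Measure ℝ) {s : Set ℝ} (hs : MeasurableSet s) :
    branch M μ s = 2⁻¹ * μ (leftMap M ⁻¹' s) + 2⁻¹ * μ (rightMap M ⁻¹' s) := by
  simp [branch, Measure.map_apply continuous_leftMap.measurable hs,
    Measure.map_apply continuous_rightMap.measurable hs]

theorem isProbabilityMeasure_branch (μ : Measure ℝ) [IsProbabilityMeasure μ] :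
    IsProbabilityMeasure (branch M μ) :=
  ⟨by rw [branch_apply μ MeasurableSet.univ]; simp [ENNReal.inv_two_add_inv_two]⟩

theorem integral_branch (μ : Measure ℝ) [IsProbabilityMeasure μ] {f : ℝ → ℝ}
    (hf : Measurable f) {C : ℝ} (hC : ∀ x, |f x| ≤ C) :
    ∫ x, f x ∂(branch M μ)
      = 1 / 2 * ∫ y, f (leftMap M y) ∂μ + 1 / 2 * ∫ y, f (rightMap M y) ∂μ := by
  have h1 : IsProbabilityMeasure (μ.map (leftMap M)) :=
    Measure.isProbabilityMeasure_map continuous_leftMap.aemeasurable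
  have h2 : IsProbabilityMeasure (μ.map (rightMap M)) :=
    Measure.isProbabilityMeasure_map continuous_rightMap.aemeasurable
  have hint : ∀ ν : Measure ℝ, IsProbabilityMeasure ν →
      Integrable f ((2⁻¹ : ℝ≥0∞) • ν) := fun ν _ =>
    (Integrable.of_bound hf.aestronglyMeasurable C (ae_of_all _ hC)).smul_measure (by simp)
  rw [branch, integral_add_measure (hint _ h1) (hint _ h2), integral_smul_measure,
    integral_smul_measure, integral_map continuous_leftMap.aemeasurable hf.aestronglyMeasurable,
    integral_map continuous_rightMap.aemeasurable hf.aestronglyMeasurable]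
  simp

theorem leftMap_mem (h : Admissible M α) {y : ℝ} (hy : y ∈ Set.Icc (0 : ℝ) 1) :
    leftMap M y ∈ Set.Icc (0 : ℝ) 1 := by
  have := h.lt_M
  exact ⟨div_nonneg hy.1 h.M_pos.le, (div_le_one h.M_pos).2 (by linarith [hy.2])⟩

theorem rightMap_mem (h : Admissible M α) {y : ℝ} (hy : y ∈ Set.Icc (0 : ℝ) 1) :
    rightMap M y ∈ Set.Icc (0 : ℝ) 1 := by
  have := h.lt_M
  exact ⟨div_nonneg (by linarith [hy.1]) h.M_pos.le, (div_le_one h.M_pos).2 (by linarith [hy.2])⟩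

/-- After k branchings both measures are averages of 2^k copies of their initial measures, shrunk
into the same intervals of length M^(-k), so only the oscillation of f at that scale matters. The
induction moves the contractions from the measures onto f; the factor 2 comes from comparing both
integrals with f 0. -/
theorem abs_integral_sub_le (h : Admissible M α) (μ ν : ℕ → Measure ℝ)
    [∀ k, IsProbabilityMeasure (μ k)] [∀ k, IsProbabilityMeasure (ν k)]
    (hμ0 : μ 0 (Set.Icc (0 : ℝ) 1)ᶜ = 0) (hν0 : ν 0 (Set.Icc (0 : ℝ) 1)ᶜ = 0)
    (hμ : ∀ k, μ (k + 1) = branch M (μ k)) (hν : ∀ k, ν (k + 1) = branch M (ν k))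
    {ε : ℝ} (k : ℕ) (f : ℝ →ᵇ ℝ)
    (hf : ∀ x ∈ Set.Icc (0 : ℝ) 1, ∀ y ∈ Set.Icc (0 : ℝ) 1, |x - y| ≤ 1 / M ^ k → |f x - f y| ≤ ε) :
    |∫ x, f x ∂(μ k) - ∫ x, f x ∂(ν k)| ≤ 2 * ε := by
  induction k generalizing f with
  | zero =>
    have key : ∀ τ : Measure ℝ, IsProbabilityMeasure τ → τ (Set.Icc (0 : ℝ) 1)ᶜ = 0 →
        |∫ x, f x ∂τ - f 0| ≤ ε := by
      intro τ _ hτ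
      have h1 : ∫ x, (f x - f 0) ∂τ = ∫ x, f x ∂τ - f 0 := by
        rw [integral_sub (f.integrable τ) (integrable_const _)]; simp
      rw [← h1, ← Real.norm_eq_abs]
      refine (norm_integral_le_of_norm_le_const (C := ε) ?_).trans (by simp)
      filter_upwards [compl_mem_ae_iff.2 hτ] with x hx
      rw [compl_compl] at hx
      refine hf x hx 0 (by simp) ?_
      rw [sub_zero, abs_of_nonneg hx.1]
      simpa using hx.2
    have h1 := key _ inferInstance hμ0
    have h2 := key _ inferInstance hν0
    rw [abs_le] at *
    constructor <;> linarith [h1.1, h1.2, h2.1, h2.2]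
  | succ k ih =>
    have hM := h.M_pos
    have h1 := ih (f.compContinuous ⟨_, continuous_leftMap (M := M)⟩)
      (fun x hx y hy hxy => hf _ (leftMap_mem h hx) _ (leftMap_mem h hy) (by
        simp only [ContinuousMap.coe_mk, leftMap]
        rw [← sub_div, abs_div, abs_of_pos hM, pow_succ, ← div_div]
        gcongr))
    have h2 := ih (f.compContinuous ⟨_, continuous_rightMap (M := M)⟩)
      (fun x hx y hy hxy => hf _ (rightMap_mem h hx) _ (rightMap_mem h hy) (by
        simp only [ContinuousMap.coe_mk, rightMap]
        rw [← sub_div, abs_div, abs_of_pos hM, pow_succ, ← div_div, add_sub_add_right_eq_sub]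
        gcongr))
    rw [hμ, hν, integral_branch _ f.continuous.measurable f.norm_coe_le_norm,
      integral_branch _ f.continuous.measurable f.norm_coe_le_norm]
    simp only [BoundedContinuousFunction.compContinuous_apply, ContinuousMap.coe_mk] at h1 h2
    rw [abs_le] at *
    constructor <;> linarith [h1.1, h1.2, h2.1, h2.2]

theorem tendsto_integral_of_branch (h : Admissible M α) (μ : ℕ → Measure ℝ) (ν : Measure ℝ)
    [∀ k, IsProbabilityMeasure (μ k)] [IsProbabilityMeasure ν]
    (hμ0 : μ 0 (Set.Icc (0 : ℝ) 1)ᶜ = 0) (hν0 : ν (Set.Icc (0 : ℝ) 1)ᶜ = 0)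
    (hμ : ∀ k, μ (k + 1) = branch M (μ k)) (hν : ν = branch M ν) (f : ℝ →ᵇ ℝ) :
    Tendsto (fun k => ∫ x, f x ∂(μ k)) atTop (𝓝 (∫ x, f x ∂ν)) := by
  rw [Metric.tendsto_atTop]
  intro ε hε
  have huc := isCompact_Icc.uniformContinuousOn_of_continuous (s := Set.Icc (0 : ℝ) 1)
    f.continuous.continuousOn
  obtain ⟨δ, hδ, hfδ⟩ := Metric.uniformContinuousOn_iff.1 huc (ε / 4) (by linarith)
  obtain ⟨N, hN⟩ := exists_pow_lt_of_lt_one hδ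
    (div_lt_one h.M_pos |>.2 (by linarith [h.lt_M]) : 1 / M < 1)
  refine ⟨N, fun k hk => ?_⟩
  rw [Real.dist_eq]
  refine (abs_integral_sub_le h μ (fun _ => ν) hμ0 hν0 hμ (fun _ => hν) (ε := ε / 4) k f ?_).trans_lt
    (by linarith)
  intro x hx y hy hxy
  refine (hfδ x hx y hy (lt_of_le_of_lt hxy (lt_of_le_of_lt ?_ hN))).le
  rw [div_pow, one_pow]
  have : 0 < M ^ N := pow_pos h.M_pos N
  gcongr
  linarith [h.lt_M]

theorem eq_of_branch_eq (h : Admissible M α) (μ ν : Measure ℝ)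
    [IsProbabilityMeasure μ] [IsProbabilityMeasure ν]
    (hμ0 : μ (Set.Icc (0 : ℝ) 1)ᶜ = 0) (hν0 : ν (Set.Icc (0 : ℝ) 1)ᶜ = 0)
    (hμ : μ = branch M μ) (hν : ν = branch M ν) : μ = ν :=
  ext_of_forall_integral_eq_of_IsFiniteMeasure fun f =>
    tendsto_nhds_unique tendsto_const_nhds
      (tendsto_integral_of_branch h (fun _ => μ) ν hμ0 hν0 (fun _ => hμ) hν f)

/-! ### A self-similar measure as the law of a random series -/

theorem lintegral_comp_affine {a : ℝ} (ha : 0 < a) (b : ℝ) {g : ℝ → ℝ≥0∞} (hg : Measurable g) :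
    ∫⁻ x, g (a * x - b) = ENNReal.ofReal (1 / a) * ∫⁻ x, g x := by
  have h1 : ∫⁻ x, g (a * x - b) = ∫⁻ y, g (y - b) ∂(volume.map (a * ·)) :=
    (lintegral_map (hg.comp (measurable_id.sub_const b)) (measurable_const_mul a)).symm
  rw [h1, Real.map_volume_mul_left ha.ne', lintegral_smul_measure, lintegral_sub_right_eq_self g b,
    abs_of_pos (inv_pos.2 ha), smul_eq_mul, one_div]

/-- The `n`-th binary digit of a number in `[0, 1)`. -/
def binDigit (n : ℕ) (t : ℝ) : ℝ := ((⌊2 ^ (n + 1) * t⌋ % 2 : ℤ) : ℝ)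

theorem measurable_binDigit (n : ℕ) : Measurable (binDigit n) :=
  (measurable_from_top (f := fun z : ℤ => ((z % 2 : ℤ) : ℝ))).comp
    (Int.measurable_floor.comp (measurable_const_mul _))

theorem binDigit_mem (n : ℕ) (t : ℝ) : binDigit n t ∈ Set.Icc (0 : ℝ) 1 := by
  unfold binDigit
  have h1 : 0 ≤ ⌊2 ^ (n + 1) * t⌋ % 2 := by omega
  have h2 : ⌊2 ^ (n + 1) * t⌋ % 2 ≤ 1 := by omega
  exact ⟨by exact_mod_cast h1, by exact_mod_cast h2⟩

theorem binDigit_succ (n : ℕ) (t : ℝ) : binDigit (n + 1) t = binDigit n (2 * t) := by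
  unfold binDigit
  rw [pow_succ, mul_assoc]

theorem binDigit_sub_one (n : ℕ) (t : ℝ) : binDigit n (t - 1) = binDigit n t := by
  unfold binDigit
  have : (2 : ℝ) ^ (n + 1) * (t - 1) = 2 ^ (n + 1) * t - ((2 * 2 ^ n : ℤ) : ℝ) := by
    push_cast; ring
  rw [this, Int.floor_sub_intCast, Int.sub_mul_emod_self_left]

theorem binDigit_zero_of_lt {t : ℝ} (h0 : 0 ≤ t) (h1 : t < 1 / 2) : binDigit 0 t = 0 := by
  have : ⌊(2 : ℝ) ^ (0 + 1) * t⌋ = 0 := by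
    rw [Int.floor_eq_iff]; constructor <;> norm_num <;> linarith
  rw [binDigit, this]; simp

theorem binDigit_zero_of_ge {t : ℝ} (h0 : 1 / 2 ≤ t) (h1 : t < 1) : binDigit 0 t = 1 := by
  have : ⌊(2 : ℝ) ^ (0 + 1) * t⌋ = 1 := by
    rw [Int.floor_eq_iff]; constructor <;> norm_num <;> linarith
  rw [binDigit, this]; simp

/-- The point of the Cantor set with given binary digits. -/
def cantorCode (M t : ℝ) : ℝ := ∑' n : ℕ, (M - 1) / M ^ (n + 1) * binDigit n t

theorem hasSum_weights (h : Admissible M α) : HasSum (fun n : ℕ => (M - 1) / M ^ (n + 1)) 1 := by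
  have hM := h.lt_M
  have h1 := (hasSum_geometric_of_lt_one (r := 1 / M) (by have := h.M_pos; positivity)
    (div_lt_one h.M_pos |>.2 (by linarith))).mul_left ((M - 1) / M)
  have h2 : (M - 1) / M * (1 - 1 / M)⁻¹ = 1 := by
    have : M ≠ 0 := h.M_pos.ne'
    have : M - 1 ≠ 0 := by linarith
    field_simp
  rw [h2] at h1
  refine (congrArg (HasSum · 1) (funext fun n => ?_)).mpr h1
  rw [pow_succ, div_pow, one_pow, mul_comm (M ^ n), div_mul_div_comm, mul_one]

theorem summable_code (h : Admissible M α) (t : ℝ) :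
    Summable (fun n : ℕ => (M - 1) / M ^ (n + 1) * binDigit n t) := by
  have hw : ∀ n : ℕ, 0 ≤ (M - 1) / M ^ (n + 1) := fun n =>
    div_nonneg (by linarith [h.lt_M]) (pow_nonneg h.M_pos.le _)
  exact Summable.of_nonneg_of_le (fun n => mul_nonneg (hw n) (binDigit_mem n t).1)
    (fun n => mul_le_of_le_one_right (hw n) (binDigit_mem n t).2) (hasSum_weights h).summable

theorem cantorCode_mem (h : Admissible M α) (t : ℝ) : cantorCode M t ∈ Set.Icc (0 : ℝ) 1 := by
  have hw : ∀ n : ℕ, 0 ≤ (M - 1) / M ^ (n + 1) := fun n =>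
    div_nonneg (by linarith [h.lt_M]) (pow_nonneg h.M_pos.le _)
  refine ⟨tsum_nonneg fun n => mul_nonneg (hw n) (binDigit_mem n t).1, ?_⟩
  rw [← (hasSum_weights h).tsum_eq]
  exact (summable_code h t).tsum_le_tsum
    (fun n => mul_le_of_le_one_right (hw n) (binDigit_mem n t).2) (hasSum_weights h).summable

theorem measurable_cantorCode (h : Admissible M α) : Measurable (cantorCode M) := by
  refine measurable_of_tendsto_metrizable (f := fun n t =>
    ∑ j ∈ Finset.range n, (M - 1) / M ^ (j + 1) * binDigit j t) (fun n => ?_)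
    (tendsto_pi_nhds.2 fun t => (summable_code h t).hasSum.tendsto_sum_nat)
  exact Finset.measurable_fun_sum _ fun j _ => (measurable_binDigit j).const_mul _

theorem cantorCode_eq (h : Admissible M α) (t : ℝ) :
    cantorCode M t = (cantorCode M (2 * t) + (M - 1) * binDigit 0 t) / M := by
  unfold cantorCode
  rw [(summable_code h t).tsum_eq_zero_add, add_div, add_comm, ← tsum_div_const]
  congr 1
  · congr 1; ext n
    rw [binDigit_succ, pow_succ M (n + 1), ← div_div]
    ring
  · rw [zero_add, pow_one]; ring

theorem cantorCode_sub_one (t : ℝ) : cantorCode M (t - 1) = cantorCode M t := by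
  unfold cantorCode
  simp_rw [binDigit_sub_one]

/-- The uniform measure on the Cantor set. -/
def cantorMeasure (M : ℝ) : Measure ℝ := (volume.restrict (Set.Ico 0 1)).map (cantorCode M)

theorem isProbabilityMeasure_cantorMeasure (h : Admissible M α) :
    IsProbabilityMeasure (cantorMeasure M) := by
  have : IsProbabilityMeasure (volume.restrict (Set.Ico (0 : ℝ) 1)) := ⟨by simp⟩
  exact Measure.isProbabilityMeasure_map (measurable_cantorCode h).aemeasurable

theorem cantorMeasure_compl_unit (h : Admissible M α) :
    cantorMeasure M (Set.Icc (0 : ℝ) 1)ᶜ = 0 := by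
  rw [cantorMeasure, Measure.map_apply (measurable_cantorCode h) measurableSet_Icc.compl]
  convert measure_empty (μ := volume.restrict (Set.Ico (0 : ℝ) 1))
  ext t
  simpa using cantorCode_mem h t

/-- Doubling t modulo 1 shifts the binary digits, and the lost digit selects the contraction. The
two halves of [0,1) are thus mapped onto [0,1) by 2t and 2t - 1, each contributing the Jacobian 1/2.
-/
theorem branch_cantorMeasure (h : Admissible M α) :
    cantorMeasure M = branch M (cantorMeasure M) := by
  classical
  ext s hs
  have hc := measurable_cantorCode h
  have hl : MeasurableSet (leftMap M ⁻¹' s) := continuous_leftMap.measurable hs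
  have hr : MeasurableSet (rightMap M ⁻¹' s) := continuous_rightMap.measurable hs
  have key : ∀ u : Set ℝ, MeasurableSet u → cantorMeasure M u
      = ∫⁻ t, (Set.Ico (0 : ℝ) 1 ∩ cantorCode M ⁻¹' u).indicator 1 t := by
    intro u hu
    rw [cantorMeasure, Measure.map_apply hc hu, Measure.restrict_apply (hc hu),
      lintegral_indicator_one (measurableSet_Ico.inter (hc hu)), Set.inter_comm]
  have hm : ∀ u : Set ℝ, MeasurableSet u → Measurable
      ((Set.Ico (0 : ℝ) 1 ∩ cantorCode M ⁻¹' u).indicator (1 : ℝ → ℝ≥0∞)) := fun u hu =>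
    measurable_one.indicator (measurableSet_Ico.inter (hc hu))
  have hhalf : ENNReal.ofReal (1 / 2) = 2⁻¹ := by
    rw [one_div, ENNReal.ofReal_inv_of_pos (by norm_num)]; simp
  rw [branch_apply _ hs, key _ hs, key _ hl, key _ hr, ← hhalf,
    ← lintegral_comp_affine two_pos 0 (hm _ hl), ← lintegral_comp_affine two_pos 1 (hm _ hr),
    ← lintegral_add_left (f := fun t => (Set.Ico (0 : ℝ) 1 ∩ cantorCode M ⁻¹'
      (leftMap M ⁻¹' s)).indicator 1 (2 * t - 0))
      ((hm _ hl).comp ((measurable_const_mul 2).sub_const 0))]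
  congr 1
  ext t
  simp only [Set.indicator_apply, Set.mem_inter_iff, Set.mem_preimage, Set.mem_Ico, Pi.one_apply,
    sub_zero, cantorCode_sub_one, leftMap, rightMap]
  rw [cantorCode_eq h t]
  rcases lt_or_ge t 0 with h0 | h0
  · rw [if_neg (by rintro ⟨⟨_, _⟩, _⟩; linarith), if_neg (by rintro ⟨⟨_, _⟩, _⟩; linarith),
      if_neg (by rintro ⟨⟨_, _⟩, _⟩; linarith), add_zero]
  rcases lt_or_ge t (1 / 2) with h1 | h1
  · rw [binDigit_zero_of_lt h0 h1, if_neg (c := (_ ≤ 2 * t - 1 ∧ _) ∧ _)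
      (by rintro ⟨⟨_, _⟩, _⟩; linarith), mul_zero, add_zero, add_zero]
    have e : (0 ≤ t ∧ t < 1) ↔ (0 ≤ 2 * t ∧ 2 * t < 1) :=
      ⟨fun _ => ⟨by linarith, by linarith⟩, fun _ => ⟨by linarith, by linarith⟩⟩
    simp only [e]
  rcases lt_or_ge t 1 with h2 | h2
  · rw [binDigit_zero_of_ge h1 h2, if_neg (c := (_ ≤ 2 * t ∧ _) ∧ _)
      (by rintro ⟨⟨_, _⟩, _⟩; linarith), mul_one, zero_add]
    have e : (0 ≤ t ∧ t < 1) ↔ (0 ≤ 2 * t - 1 ∧ 2 * t - 1 < 1) :=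
      ⟨fun _ => ⟨by linarith, by linarith⟩, fun _ => ⟨by linarith, by linarith⟩⟩
    simp only [e]
  · rw [if_neg (by rintro ⟨⟨_, _⟩, _⟩; linarith), if_neg (by rintro ⟨⟨_, _⟩, _⟩; linarith),
      if_neg (by rintro ⟨⟨_, _⟩, _⟩; linarith), add_zero]

/-! ### The approximating intervals and densities -/

/-- The intervals are defined by appending a last binary digit of l, whereas the contractions act on
the first one. This lemma and the next switch between the two recursions. -/
theorem endpoints_left (M : ℝ) (k l : ℕ) (hl : l < 2 ^ k) :
    endpoints M (k + 1) l = (leftMap M (endpoints M k l).1, leftMap M (endpoints M k l).2) := by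
  induction k generalizing l with
  | zero =>
    have : l = 0 := by omega
    subst this
    simp [endpoints, leftMap]
  | succ k ih =>
    have hl2 : l / 2 < 2 ^ k := by rw [pow_succ] at hl; omega
    rw [endpoints, ih _ hl2, endpoints]
    unfold leftMap
    split_ifs <;> ext <;> ring

theorem endpoints_right (hM : M ≠ 0) (k l : ℕ) (hl : l < 2 ^ k) :
    endpoints M (k + 1) (2 ^ k + l)
      = (rightMap M (endpoints M k l).1, rightMap M (endpoints M k l).2) := by
  induction k generalizing l with
  | zero =>
    have : l = 0 := by omega
    subst this
    simp [endpoints, rightMap, sub_div, hM]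
  | succ k ih =>
    have hl2 : l / 2 < 2 ^ k := by rw [pow_succ] at hl; omega
    have e1 : (2 ^ (k + 1) + l) / 2 = 2 ^ k + l / 2 := by rw [pow_succ]; omega
    have e2 : (2 ^ (k + 1) + l) % 2 = l % 2 := by rw [pow_succ]; omega
    rw [endpoints, e1, e2, ih _ hl2, endpoints]
    unfold rightMap
    split_ifs <;> ext <;> ring

theorem endpoints_sub (M : ℝ) (k l : ℕ) :
    (endpoints M k l).2 - (endpoints M k l).1 = 1 / M ^ k := by
  induction k generalizing l with
  | zero => simp [endpoints]
  | succ k ih =>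
    rw [endpoints]
    split_ifs <;> simp only [add_sub_cancel_left, sub_sub_cancel] <;>
      rw [ih, pow_succ, div_div]

theorem mem_interval_left (h : Admissible M α) {k l : ℕ} (hl : l < 2 ^ k) {x : ℝ} :
    x ∈ interval M (k + 1) l ↔ M * x ∈ interval M k l := by
  rw [interval, interval, endpoints_left M k l hl]
  simp only [leftMap, Set.mem_Icc, div_le_iff₀' h.M_pos, le_div_iff₀' h.M_pos]

theorem mem_interval_right (h : Admissible M α) {k l : ℕ} (hl : l < 2 ^ k) {x : ℝ} :
    x ∈ interval M (k + 1) (2 ^ k + l) ↔ M * x - (M - 1) ∈ interval M k l := by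
  rw [interval, interval, endpoints_right h.M_pos.ne' k l hl]
  simp only [rightMap, Set.mem_Icc, div_le_iff₀' h.M_pos, le_div_iff₀' h.M_pos, sub_le_iff_le_add,
    le_sub_iff_add_le]

theorem mem_level {k : ℕ} {x : ℝ} : x ∈ level M k ↔ ∃ l < 2 ^ k, x ∈ interval M k l := by
  simp [level]

theorem mem_level_succ (h : Admissible M α) {k : ℕ} {x : ℝ} :
    x ∈ level M (k + 1) ↔ M * x ∈ level M k ∨ M * x - (M - 1) ∈ level M k := by
  simp only [mem_level]
  constructor
  · rintro ⟨l, hl, hx⟩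
    rcases lt_or_ge l (2 ^ k) with h1 | h1
    · exact Or.inl ⟨l, h1, (mem_interval_left h h1).1 hx⟩
    · obtain ⟨m, rfl⟩ := Nat.exists_eq_add_of_le h1
      have hm : m < 2 ^ k := by rw [pow_succ] at hl; omega
      exact Or.inr ⟨m, hm, (mem_interval_right h hm).1 hx⟩
  · rintro (⟨l, hl, hx⟩ | ⟨l, hl, hx⟩)
    · exact ⟨l, by rw [pow_succ]; omega, (mem_interval_left h hl).2 hx⟩
    · exact ⟨2 ^ k + l, by rw [pow_succ]; omega, (mem_interval_right h hl).2 hx⟩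

theorem level_zero : level M 0 = Set.Icc 0 1 := by
  ext x; simp [mem_level, interval, endpoints]

theorem level_subset_unit (h : Admissible M α) (k : ℕ) : level M k ⊆ Set.Icc 0 1 := by
  induction k with
  | zero => rw [level_zero]
  | succ k ih =>
    intro x hx
    have hM := h.lt_M
    rcases (mem_level_succ h).1 hx with hx | hx
    · have := ih hx
      constructor <;> nlinarith [this.1, this.2]
    · have := ih hx
      constructor <;> nlinarith [this.1, this.2]

theorem isClosed_level (k : ℕ) : IsClosed (level M k) :=
  isClosed_biUnion_finset fun _ _ => isClosed_Icc

/-! ### The measures ρ_k as iterates of the branching operator. -/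

theorem rhoDensity_succ (h : Admissible M α) (k : ℕ) (x : ℝ) :
    rhoDensity M (k + 1) x
      = M / 2 * rhoDensity M k (M * x) + M / 2 * rhoDensity M k (M * x - (M - 1)) := by
  classical
  unfold rhoDensity
  have e : 2 ^ (k + 1) = 2 ^ k + 2 ^ k := by ring
  have h1 : ∑ l ∈ Finset.range (2 ^ k), (interval M (k + 1) l).indicator (fun _ => (1 : ℝ)) x
      = ∑ l ∈ Finset.range (2 ^ k), (interval M k l).indicator (fun _ => (1 : ℝ)) (M * x) := by
    refine Finset.sum_congr rfl fun l hl => ?_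
    simp only [Set.indicator_apply, mem_interval_left h (Finset.mem_range.1 hl)]
  have h2 : ∑ l ∈ Finset.range (2 ^ k),
        (interval M (k + 1) (2 ^ k + l)).indicator (fun _ => (1 : ℝ)) x
      = ∑ l ∈ Finset.range (2 ^ k),
        (interval M k l).indicator (fun _ => (1 : ℝ)) (M * x - (M - 1)) := by
    refine Finset.sum_congr rfl fun l hl => ?_
    simp only [Set.indicator_apply, mem_interval_right h (Finset.mem_range.1 hl)]
  rw [e, Finset.sum_range_add, h1, h2]
  ring

theorem rhoDensity_nonneg (h : Admissible M α) (k : ℕ) (x : ℝ) : 0 ≤ rhoDensity M k x :=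
  mul_nonneg (pow_nonneg (by linarith [h.M_pos]) _)
    (Finset.sum_nonneg fun _ _ => Set.indicator_nonneg (fun _ _ => zero_le_one) _)

theorem measurable_rhoDensity (k : ℕ) : Measurable (rhoDensity M k) :=
  (Finset.measurable_fun_sum _ fun _ _ =>
    measurable_const.indicator measurableSet_Icc).const_mul _

theorem rhoMeasure_zero : rhoMeasure M 0 = volume.restrict (Set.Icc 0 1) := by
  classical
  have : (fun x => ENNReal.ofReal (rhoDensity M 0 x)) = (Set.Icc (0 : ℝ) 1).indicator 1 := by
    ext x
    by_cases hx : x ∈ Set.Icc (0 : ℝ) 1 <;> simp [rhoDensity, interval, endpoints, hx]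
  rw [rhoMeasure, this, withDensity_indicator_one measurableSet_Icc]

theorem rhoMeasure_succ (h : Admissible M α) (k : ℕ) :
    rhoMeasure M (k + 1) = branch M (rhoMeasure M k) := by
  ext s hs
  have hM := h.M_pos
  have hd := (measurable_rhoDensity (M := M) k).ennreal_ofReal
  have hl : MeasurableSet (leftMap M ⁻¹' s) := continuous_leftMap.measurable hs
  have hr : MeasurableSet (rightMap M ⁻¹' s) := continuous_rightMap.measurable hs
  -- Here f is one of the two contractions, inverted by x ↦ Mx - b. The weight 1/2 is the density
  -- factor M/2 times the Jacobian 1/M.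
  have key : ∀ (b : ℝ) (f : ℝ → ℝ), MeasurableSet (f ⁻¹' s) → (∀ x, f (M * x - b) = x) →
      2⁻¹ * rhoMeasure M k (f ⁻¹' s)
        = ∫⁻ x in s, ENNReal.ofReal (M / 2 * rhoDensity M k (M * x - b)) := by
    intro b f hf hfb
    rw [rhoMeasure, withDensity_apply _ hf, ← lintegral_indicator hf, ← lintegral_indicator hs]
    have h1 := lintegral_comp_affine hM b (hd.indicator hf)
    have h2 : ENNReal.ofReal (M / 2) * ENNReal.ofReal (1 / M) = 2⁻¹ := by
      rw [← ENNReal.ofReal_mul (by positivity)]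
      have : M / 2 * (1 / M) = 2⁻¹ := by field_simp
      rw [this, ENNReal.ofReal_inv_of_pos two_pos]; simp
    have h3 : Measurable fun x =>
        (f ⁻¹' s).indicator (fun x => ENNReal.ofReal (rhoDensity M k x)) (M * x - b) :=
      (hd.indicator hf).comp ((measurable_const_mul M).sub_const b)
    rw [← h2, mul_assoc, ← h1, ← lintegral_const_mul _ h3]
    congr 1
    ext x
    have hx : M * x - b ∈ f ⁻¹' s ↔ x ∈ s := by rw [Set.mem_preimage, hfb]
    by_cases hxs : x ∈ s
    · rw [Set.indicator_of_mem (hx.2 hxs), Set.indicator_of_mem hxs,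
        ENNReal.ofReal_mul (by positivity)]
    · rw [Set.indicator_of_notMem (fun h' => hxs (hx.1 h')), Set.indicator_of_notMem hxs, mul_zero]
  have h0 := key 0 (leftMap M) hl (fun x => by unfold leftMap; field_simp; ring)
  have h1 := key (M - 1) (rightMap M) hr (fun x => by unfold rightMap; field_simp; ring)
  simp only [sub_zero] at h0
  rw [branch_apply _ hs, h0, h1, rhoMeasure, withDensity_apply _ hs, ← lintegral_add_left]
  · congr 1
    ext x
    have hM2 : 0 ≤ M / 2 := by positivity
    rw [rhoDensity_succ h, ENNReal.ofReal_add] <;>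
      exact mul_nonneg hM2 (rhoDensity_nonneg h _ _)
  · exact (((measurable_rhoDensity k).comp (measurable_const_mul M)).const_mul _).ennreal_ofReal

theorem isProbabilityMeasure_rhoMeasure (h : Admissible M α) (k : ℕ) :
    IsProbabilityMeasure (rhoMeasure M k) := by
  induction k with
  | zero => rw [rhoMeasure_zero]; exact ⟨by simp⟩
  | succ k ih => rw [rhoMeasure_succ h]; exact isProbabilityMeasure_branch _

theorem weakLimit_rhoMeasure (h : Admissible M α) :
    WeakLimit (rhoMeasure M) (cantorMeasure M) := by
  have := isProbabilityMeasure_rhoMeasure h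
  have := isProbabilityMeasure_cantorMeasure h
  refine fun f => tendsto_integral_of_branch h _ _ ?_ (cantorMeasure_compl_unit h)
    (rhoMeasure_succ h) (branch_cantorMeasure h) f
  rw [rhoMeasure_zero, Measure.restrict_apply measurableSet_Icc.compl]
  simp

/-! ### Properties of the Cantor measure -/

theorem ae_mem_unit (h : Admissible M α) : ∀ᵐ y ∂(cantorMeasure M), y ∈ Set.Icc (0 : ℝ) 1 := by
  have := compl_mem_ae_iff.2 (cantorMeasure_compl_unit h)
  rwa [compl_compl] at this

theorem integral_cantorMeasure (h : Admissible M α) {f : ℝ → ℝ} (hf : Measurable f) {C : ℝ}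
    (hC : ∀ x, |f x| ≤ C) :
    ∫ x, f x ∂(cantorMeasure M) = 1 / 2 * ∫ y, f (leftMap M y) ∂(cantorMeasure M)
      + 1 / 2 * ∫ y, f (rightMap M y) ∂(cantorMeasure M) := by
  have := isProbabilityMeasure_cantorMeasure h
  conv_lhs => rw [branch_cantorMeasure h]
  exact integral_branch _ hf hC

/-- Reflection swaps the two contractions, so the reflected measure is again fixed by `branch`, and
the fixed point is unique. -/
theorem cantorMeasure_reflect (h : Admissible M α) :
    (cantorMeasure M).map (fun y => 1 - y) = cantorMeasure M := by
  have := isProbabilityMeasure_cantorMeasure h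
  have hm : Measurable fun y : ℝ => 1 - y := measurable_const.sub measurable_id
  have hmap : IsProbabilityMeasure ((cantorMeasure M).map (fun y => 1 - y)) :=
    Measure.isProbabilityMeasure_map hm.aemeasurable
  have hM := h.M_pos.ne'
  refine eq_of_branch_eq h _ _ ?_ (cantorMeasure_compl_unit h) ?_ (branch_cantorMeasure h)
  · rw [Measure.map_apply hm measurableSet_Icc.compl]
    refine measure_mono_null (fun y hy => ?_) (cantorMeasure_compl_unit h)
    simp only [Set.mem_preimage, Set.mem_compl_iff, Set.mem_Icc] at hy ⊢
    exact fun hy' => hy ⟨by linarith [hy'.2], by linarith [hy'.1]⟩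
  · ext s hs
    have hl : MeasurableSet (leftMap M ⁻¹' s) := continuous_leftMap.measurable hs
    have hr : MeasurableSet (rightMap M ⁻¹' s) := continuous_rightMap.measurable hs
    rw [branch_apply _ hs, Measure.map_apply hm hs, Measure.map_apply hm hl,
      Measure.map_apply hm hr]
    conv_lhs => rw [branch_cantorMeasure h, branch_apply _ (hm hs), add_comm]
    simp only [← Set.preimage_comp]
    congr 4
    · ext y; simp only [Function.comp_apply, rightMap, leftMap]; field_simp; ring
    · ext y; simp only [Function.comp_apply, rightMap, leftMap]; field_simp; ring

theorem integral_reflect (h : Admissible M α) {f : ℝ → ℝ} (hf : Measurable f) :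
    ∫ y, f (1 - y) ∂(cantorMeasure M) = ∫ y, f y ∂(cantorMeasure M) := by
  have hm : Measurable fun y : ℝ => 1 - y := measurable_const.sub measurable_id
  conv_rhs => rw [← cantorMeasure_reflect h, integral_map hm.aemeasurable hf.aestronglyMeasurable]

theorem integrable_of_bounded (h : Admissible M α) {f : ℝ → ℝ} (hf : Measurable f) {C : ℝ}
    (hC : ∀ x ∈ Set.Icc (0 : ℝ) 1, |f x| ≤ C) : Integrable f (cantorMeasure M) := by
  have := isProbabilityMeasure_cantorMeasure h
  refine Integrable.of_bound hf.aestronglyMeasurable C ?_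
  filter_upwards [ae_mem_unit h] with y hy using hC y hy

theorem integrable_id (h : Admissible M α) : Integrable (fun y : ℝ => y) (cantorMeasure M) :=
  integrable_of_bounded h measurable_id (C := 1) fun x hx => by
    rw [abs_of_nonneg hx.1]; exact hx.2

theorem integral_id (h : Admissible M α) : ∫ y, y ∂(cantorMeasure M) = 1 / 2 := by
  have := isProbabilityMeasure_cantorMeasure h
  have h1 := integral_reflect h measurable_id
  simp only [id] at h1
  rw [integral_sub (integrable_const _) (integrable_id h)] at h1
  simp only [integral_const, probReal_univ, one_smul] at h1
  linarith

theorem real_cantorMeasure (h : Admissible M α) {s : Set ℝ} (hs : MeasurableSet s) :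
    (cantorMeasure M).real s = 1 / 2 * (cantorMeasure M).real (leftMap M ⁻¹' s)
      + 1 / 2 * (cantorMeasure M).real (rightMap M ⁻¹' s) := by
  have := isProbabilityMeasure_cantorMeasure h
  simp only [measureReal_def]
  conv_lhs => rw [branch_cantorMeasure h, branch_apply _ hs]
  rw [ENNReal.toReal_add (ENNReal.mul_ne_top (by simp) (measure_ne_top _ _))
    (ENNReal.mul_ne_top (by simp) (measure_ne_top _ _)), ENNReal.toReal_mul, ENNReal.toReal_mul]
  simp

theorem real_eq_zero_of_disjoint (h : Admissible M α) {s : Set ℝ}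
    (hs : ∀ y ∈ Set.Icc (0 : ℝ) 1, y ∉ s) : (cantorMeasure M).real s = 0 := by
  rw [measureReal_def, measure_mono_null (fun y hy hy' => hs y hy' hy) (cantorMeasure_compl_unit h)]
  simp

/-- Expanding by M yields two intervals of length at most 1, translates of each other by M - 1. Only
one of them can meet [0,1], so each step costs a factor 1/2. -/
theorem real_Icc_le (h : Admissible M α) (n : ℕ) (a : ℝ) :
    (cantorMeasure M).real (Set.Icc a (a + 1 / M ^ n)) ≤ (1 / 2) ^ n := by
  have := isProbabilityMeasure_cantorMeasure h
  induction n generalizing a with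
  | zero => simp
  | succ n ih =>
    have hM := h.lt_M
    have hM0 := h.M_pos
    have hMn : 0 < M ^ n := pow_pos hM0 n
    have e : M * (1 / M ^ (n + 1)) = 1 / M ^ n := by rw [pow_succ]; field_simp
    have h1 : leftMap M ⁻¹' (Set.Icc a (a + 1 / M ^ (n + 1)))
        = Set.Icc (M * a) (M * a + 1 / M ^ n) := by
      ext y
      simp only [leftMap, Set.mem_preimage, Set.mem_Icc, div_le_iff₀' hM0, le_div_iff₀' hM0,
        mul_add, e]
    have h2 : rightMap M ⁻¹' (Set.Icc a (a + 1 / M ^ (n + 1)))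
        = Set.Icc (M * a - (M - 1)) (M * a - (M - 1) + 1 / M ^ n) := by
      ext y
      simp only [rightMap, Set.mem_preimage, Set.mem_Icc, div_le_iff₀' hM0, le_div_iff₀' hM0,
        mul_add, e]
      constructor <;> rintro ⟨_, _⟩ <;> constructor <;> linarith
    rw [real_cantorMeasure h measurableSet_Icc, h1, h2, pow_succ]
    have hle : 1 / M ^ n ≤ 1 := by
      rw [div_le_one hMn]; exact one_le_pow₀ (by linarith)
    rcases le_or_gt (M * a) 1 with ha | ha
    · rw [real_eq_zero_of_disjoint h (s := Set.Icc (M * a - (M - 1)) _)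
        (fun y hy hy' => by linarith [hy.1, hy'.2])]
      linarith [ih (M * a)]
    · rw [real_eq_zero_of_disjoint h (s := Set.Icc (M * a) _)
        (fun y hy hy' => by linarith [hy.2, hy'.1])]
      linarith [ih (M * a - (M - 1))]

theorem noAtoms_cantorMeasure (h : Admissible M α) (x : ℝ) : cantorMeasure M {x} = 0 := by
  have := isProbabilityMeasure_cantorMeasure h
  rw [← measureReal_eq_zero_iff]
  refine le_antisymm (ge_of_tendsto' (tendsto_pow_atTop_nhds_zero_of_lt_one
    (by norm_num) (by norm_num : (1 / 2 : ℝ) < 1)) fun n => ?_) measureReal_nonneg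
  refine (measureReal_mono (Set.singleton_subset_iff.2 ?_)).trans (real_Icc_le h n x)
  have : 0 < M ^ n := pow_pos h.M_pos n
  exact ⟨le_rfl, by linarith [one_div_pos.2 this]⟩

theorem real_interval_ge (h : Admissible M α) (k l : ℕ) (hl : l < 2 ^ k) :
    (1 / 2) ^ k ≤ (cantorMeasure M).real (interval M k l) := by
  have := isProbabilityMeasure_cantorMeasure h
  have hM := h.M_pos.ne'
  induction k generalizing l with
  | zero =>
    have : interval M 0 l = Set.Icc 0 1 := by simp [interval, endpoints]
    rw [this, measureReal_def, (prob_compl_eq_zero_iff measurableSet_Icc).1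
      (cantorMeasure_compl_unit h)]
    simp
  | succ k ih =>
    rw [real_cantorMeasure h (by exact measurableSet_Icc), pow_succ]
    rcases lt_or_ge l (2 ^ k) with h1 | h1
    · have e : leftMap M ⁻¹' interval M (k + 1) l = interval M k l := by
        ext y
        rw [Set.mem_preimage, mem_interval_left h h1, leftMap, mul_div_cancel₀ _ hM]
      rw [e]
      have := ih l h1
      have := measureReal_nonneg (μ := cantorMeasure M) (s := rightMap M ⁻¹' interval M (k + 1) l)
      linarith
    · obtain ⟨m, rfl⟩ := Nat.exists_eq_add_of_le h1
      have hm : m < 2 ^ k := by rw [pow_succ] at hl; omega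
      have e : rightMap M ⁻¹' interval M (k + 1) (2 ^ k + m) = interval M k m := by
        ext y
        rw [Set.mem_preimage, mem_interval_right h hm, rightMap, mul_div_cancel₀ _ hM,
          add_sub_cancel_right]
      rw [e]
      have := ih m hm
      have := measureReal_nonneg (μ := cantorMeasure M)
        (s := leftMap M ⁻¹' interval M (k + 1) (2 ^ k + m))
      linarith

theorem cantorMeasure_compl_level (h : Admissible M α) (k : ℕ) :
    cantorMeasure M (level M k)ᶜ = 0 := by
  induction k with
  | zero => rw [level_zero]; exact cantorMeasure_compl_unit h
  | succ k ih =>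
    have hM := h.M_pos.ne'
    rw [branch_cantorMeasure h, branch_apply _ (isClosed_level _).measurableSet.compl]
    have h1 : leftMap M ⁻¹' (level M (k + 1))ᶜ ⊆ (level M k)ᶜ := by
      intro y hy hy'
      refine hy ((mem_level_succ h).2 (Or.inl ?_))
      rwa [leftMap, mul_div_cancel₀ _ hM]
    have h2 : rightMap M ⁻¹' (level M (k + 1))ᶜ ⊆ (level M k)ᶜ := by
      intro y hy hy'
      refine hy ((mem_level_succ h).2 (Or.inr ?_))
      rwa [rightMap, mul_div_cancel₀ _ hM, add_sub_cancel_right]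
    rw [measure_mono_null h1 ih, measure_mono_null h2 ih]
    simp

theorem support_cantorMeasure (h : Admissible M α) :
    (cantorMeasure M).support = cantorSet M := by
  have := isProbabilityMeasure_cantorMeasure h
  apply Set.Subset.antisymm
  · refine Measure.support_subset_of_isClosed (isClosed_iInter isClosed_level) ?_
    rw [mem_ae_iff, cantorSet, Set.compl_iInter]
    exact measure_iUnion_null fun k => cantorMeasure_compl_level h k
  · intro x hx
    rw [Measure.mem_support_iff_forall]
    intro U hU
    obtain ⟨ε, hε, hεU⟩ := Metric.mem_nhds_iff.1 hU
    obtain ⟨k, hk⟩ := exists_pow_lt_of_lt_one hε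
      (div_lt_one h.M_pos |>.2 (by linarith [h.lt_M]) : 1 / M < 1)
    obtain ⟨l, hl, hxl⟩ := mem_level.1 (Set.mem_iInter.1 hx k)
    have hsub : interval M k l ⊆ U := by
      intro y hy
      apply hεU
      have hw := endpoints_sub M k l
      rw [div_pow, one_pow] at hk
      rw [Metric.mem_ball, Real.dist_eq, abs_lt]
      constructor <;> linarith [hy.1, hy.2, hxl.1, hxl.2]
    have hpos : 0 < (cantorMeasure M).real (interval M k l) :=
      lt_of_lt_of_le (by positivity) (real_interval_ge h k l hl)
    exact lt_of_lt_of_le (ENNReal.toReal_pos_iff.1 hpos).1 (measure_mono hsub)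

/-! ### Convolutions with the Cantor measure -/

theorem measurable_sign : Measurable Real.sign := by
  have : Real.sign = fun r : ℝ => if r < 0 then (-1 : ℝ) else if 0 < r then 1 else 0 := rfl
  rw [this]
  exact Measurable.ite measurableSet_Iio measurable_const
    (Measurable.ite measurableSet_Ioi measurable_const measurable_const)

theorem abs_sign_le (x : ℝ) : |Real.sign x| ≤ 1 := by
  rcases Real.sign_apply_eq x with h | h | h <;> rw [h] <;> norm_num

theorem sign_mul_of_pos {a : ℝ} (ha : 0 < a) (x : ℝ) : Real.sign (a * x) = Real.sign x := by
  rcases lt_trichotomy x 0 with hx | rfl | hx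
  · rw [Real.sign_of_neg hx, Real.sign_of_neg (mul_neg_of_pos_of_neg ha hx)]
  · simp
  · rw [Real.sign_of_pos hx, Real.sign_of_pos (mul_pos ha hx)]

theorem abs_hatSum_le (h : Admissible M α) (x : ℝ) : |hatSum M α x| ≤ 2 := by
  rw [abs_of_nonneg (hatSum_nonneg x)]; exact hatSum_le_two h x

theorem abs_hat_le (h : Admissible M α) (x : ℝ) : |hat M α x| ≤ 2 := by
  rw [abs_of_nonneg (hat_nonneg x)]; exact hat_le_two h x

theorem measurable_comp_sub {f : ℝ → ℝ} (hf : Measurable f) (x : ℝ) :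
    Measurable fun y => f (x - y) := hf.comp (measurable_const.sub measurable_id)

theorem integrable_conv (h : Admissible M α) {f : ℝ → ℝ} (hf : Measurable f) {C : ℝ}
    (hC : ∀ x, |f x| ≤ C) (x : ℝ) : Integrable (fun y => f (x - y)) (cantorMeasure M) :=
  integrable_of_bounded h (measurable_comp_sub hf x) fun y _ => hC (x - y)

theorem conv_eq_branches (h : Admissible M α) {f g : ℝ → ℝ} (hf : Measurable f) {C : ℝ}
    (hC : ∀ x, |f x| ≤ C) (hg : ∀ x, f x = g (M * x)) (x : ℝ) :
    conv f (cantorMeasure M) x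
      = 1 / 2 * conv g (cantorMeasure M) (M * x)
        + 1 / 2 * conv g (cantorMeasure M) (M * x - (M - 1)) := by
  have hM := h.M_pos.ne'
  unfold conv
  rw [integral_cantorMeasure h (measurable_comp_sub hf x) fun y => hC (x - y)]
  simp only [hg, leftMap, rightMap, mul_sub, mul_div_cancel₀ _ hM]
  congr 2
  congr 1
  ext y
  congr 1
  ring

theorem conv_sign_rec (h : Admissible M α) (x : ℝ) :
    conv Real.sign (cantorMeasure M) x
      = 1 / 2 * conv Real.sign (cantorMeasure M) (M * x)
        + 1 / 2 * conv Real.sign (cantorMeasure M) (M * x - (M - 1)) :=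
  conv_eq_branches h measurable_sign abs_sign_le (fun x => (sign_mul_of_pos h.M_pos x).symm) x

theorem conv_hatSum_rec (h : Admissible M α) (x : ℝ) :
    conv (hatSum M α) (cantorMeasure M) x
      = 1 / 2 * (conv (hat M α) (cantorMeasure M) (M * x)
          + conv (hatSum M α) (cantorMeasure M) (M * x))
        + 1 / 2 * (conv (hat M α) (cantorMeasure M) (M * x - (M - 1))
          + conv (hatSum M α) (cantorMeasure M) (M * x - (M - 1))) := by
  rw [conv_eq_branches h (measurable_hatSum h) (abs_hatSum_le h)
    (g := fun z => hat M α z + hatSum M α z) (hatSum_rec h) x]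
  have key : ∀ z, conv (fun z => hat M α z + hatSum M α z) (cantorMeasure M) z
      = conv (hat M α) (cantorMeasure M) z + conv (hatSum M α) (cantorMeasure M) z := fun z =>
    integral_add (integrable_conv h continuous_hat.measurable (abs_hat_le h) z)
      (integrable_conv h (measurable_hatSum h) (abs_hatSum_le h) z)
  rw [key, key]

theorem conv_congr (h : Admissible M α) {f g : ℝ → ℝ} {x : ℝ}
    (hfg : ∀ y ∈ Set.Icc (0 : ℝ) 1, f (x - y) = g y) :
    conv f (cantorMeasure M) x = ∫ y, g y ∂(cantorMeasure M) := by
  refine integral_congr_ae ?_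
  filter_upwards [ae_mem_unit h] with y hy using hfg y hy

theorem integral_affine (h : Admissible M α) (a b : ℝ) :
    ∫ y, (a + b * y) ∂(cantorMeasure M) = a + b / 2 := by
  have := isProbabilityMeasure_cantorMeasure h
  rw [integral_add (integrable_const _) ((integrable_id h).const_mul b), integral_const_mul,
    integral_id h]
  simp
  ring

theorem conv_eq_affine (h : Admissible M α) {f : ℝ → ℝ} {x : ℝ} (a b : ℝ)
    (hf : ∀ y ∈ Set.Icc (0 : ℝ) 1, f (x - y) = a + b * y) :
    conv f (cantorMeasure M) x = a + b / 2 := by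
  rw [conv_congr h hf, integral_affine h]

theorem conv_ge_affine (h : Admissible M α) {f : ℝ → ℝ} (hfm : Measurable f) {C : ℝ}
    (hC : ∀ x, |f x| ≤ C) {x : ℝ} (a b : ℝ)
    (hf : ∀ y ∈ Set.Icc (0 : ℝ) 1, a + b * y ≤ f (x - y)) :
    a + b / 2 ≤ conv f (cantorMeasure M) x := by
  have := isProbabilityMeasure_cantorMeasure h
  rw [← integral_affine h a b]
  refine integral_mono_ae ((integrable_const _).add ((integrable_id h).const_mul b))
    (integrable_conv h hfm hC x) ?_
  filter_upwards [ae_mem_unit h] with y hy using hf y hy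

theorem conv_le_affine (h : Admissible M α) {f : ℝ → ℝ} (hfm : Measurable f) {C : ℝ}
    (hC : ∀ x, |f x| ≤ C) {x : ℝ} (a b : ℝ)
    (hf : ∀ y ∈ Set.Icc (0 : ℝ) 1, f (x - y) ≤ a + b * y) :
    conv f (cantorMeasure M) x ≤ a + b / 2 := by
  have := isProbabilityMeasure_cantorMeasure h
  rw [← integral_affine h a b]
  refine integral_mono_ae (integrable_conv h hfm hC x)
    ((integrable_const _).add ((integrable_id h).const_mul b)) ?_
  filter_upwards [ae_mem_unit h] with y hy using hf y hy

/-! ### Hölder continuity of convolutions -/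

/-- `b` is Lipschitz with constant `C * M ^ n` at distance `M ^ (-n)` from the origin, on either
side of it. -/
def ScaleLipschitz (M C : ℝ) (b : ℝ → ℝ) : Prop :=
  ∀ (n : ℕ) (s t : ℝ), (1 ≤ M ^ n * s ∧ 1 ≤ M ^ n * t) ∨ (M ^ n * s ≤ -1 ∧ M ^ n * t ≤ -1) →
    |b s - b t| ≤ C * M ^ n * |s - t|

theorem scaleLipschitz_hatSum (h : Admissible M α) : ScaleLipschitz M 2 (hatSum M α) := by
  rintro n s t (⟨hs, ht⟩ | ⟨hs, ht⟩)
  · exact abs_hatSum_sub_le h n hs ht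
  · have hMn : 0 < M ^ n := pow_pos h.M_pos n
    have hs' : s ≤ 0 := by
      by_contra! hs'; linarith [mul_pos hMn hs']
    have ht' : t ≤ 0 := by
      by_contra! ht'; linarith [mul_pos hMn ht']
    rw [hatSum_of_nonpos h hs', hatSum_of_nonpos h ht', sub_zero, abs_zero]
    positivity

theorem ScaleLipschitz.continuousAt (h : Admissible M α) {C : ℝ} {b : ℝ → ℝ}
    (hb : ScaleLipschitz M C b) {x : ℝ} (hx : x ≠ 0) : ContinuousAt b x := by
  have hM := h.lt_M
  have key : ∃ n : ℕ, ∀ᶠ y in 𝓝 x, |b y - b x| ≤ C * M ^ n * |y - x| := by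
    have hc : ∀ n : ℕ, Tendsto (fun y : ℝ => M ^ n * y) (𝓝 x) (𝓝 (M ^ n * x)) :=
      fun n => (continuous_const_mul (M ^ n)).continuousAt
    rcases lt_or_gt_of_ne hx with hx | hx
    · obtain ⟨n, hn⟩ := h.exists_one_le_pow_mul (neg_pos.2 hx)
      -- One extra power of M makes the inequality strict, hence stable near x.
      have hn' : M ^ (n + 1) * x < -1 := by rw [pow_succ']; nlinarith
      refine ⟨n + 1, ?_⟩
      filter_upwards [(hc (n + 1)).eventually (gt_mem_nhds hn')] with y hy
      exact hb _ _ _ (Or.inr ⟨le_of_lt hy, hn'.le⟩)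
    · obtain ⟨n, hn⟩ := h.exists_one_le_pow_mul hx
      have hn' : 1 < M ^ (n + 1) * x := by rw [pow_succ']; nlinarith
      refine ⟨n + 1, ?_⟩
      filter_upwards [(hc (n + 1)).eventually (lt_mem_nhds hn')] with y hy
      exact hb _ _ _ (Or.inl ⟨le_of_lt hy, hn'.le⟩)
  obtain ⟨n, hn⟩ := key
  rw [ContinuousAt, tendsto_iff_norm_sub_tendsto_zero]
  refine squeeze_zero' (Eventually.of_forall fun _ => norm_nonneg _) hn ?_
  have : Tendsto (fun y => C * M ^ n * |y - x|) (𝓝 x) (𝓝 (C * M ^ n * |x - x|)) := by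
    apply Continuous.tendsto; fun_prop
  simpa using this

theorem real_Icc_radius_le (h : Admissible M α) (n : ℕ) (x : ℝ) :
    (cantorMeasure M).real (Set.Icc (x - 2 * (1 / M ^ n)) (x + 2 * (1 / M ^ n)))
      ≤ 4 * (1 / 2) ^ n := by
  have := isProbabilityMeasure_cantorMeasure h
  set w := 1 / M ^ n with hw
  have h0 := real_Icc_le h n (x - 2 * w)
  have h1 := real_Icc_le h n (x - w)
  have h2 := real_Icc_le h n x
  have h3 := real_Icc_le h n (x + w)
  rw [← hw] at h0 h1 h2 h3
  have hsub : Set.Icc (x - 2 * w) (x + 2 * w) ⊆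
      ((Set.Icc (x - 2 * w) (x - 2 * w + w) ∪ Set.Icc (x - w) (x - w + w))
        ∪ Set.Icc x (x + w)) ∪ Set.Icc (x + w) (x + w + w) := by
    intro y hy
    simp only [Set.mem_union, Set.mem_Icc] at hy ⊢
    rcases le_total y (x - w) with c1 | c1
    · left; left; left; constructor <;> linarith [hy.1]
    rcases le_total y x with c2 | c2
    · left; left; right; constructor <;> linarith
    rcases le_total y (x + w) with c3 | c3
    · left; right; constructor <;> linarith
    · right; constructor <;> linarith [hy.2]
  have h4 := measureReal_mono (μ := cantorMeasure M) hsub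
  have h5 := measureReal_union_le (μ := cantorMeasure M)
    ((Set.Icc (x - 2 * w) (x - 2 * w + w) ∪ Set.Icc (x - w) (x - w + w))
        ∪ Set.Icc x (x + w)) (Set.Icc (x + w) (x + w + w))
  have h6 := measureReal_union_le (μ := cantorMeasure M)
    (Set.Icc (x - 2 * w) (x - 2 * w + w) ∪ Set.Icc (x - w) (x - w + w)) (Set.Icc x (x + w))
  have h7 := measureReal_union_le (μ := cantorMeasure M)
    (Set.Icc (x - 2 * w) (x - 2 * w + w)) (Set.Icc (x - w) (x - w + w))
  linarith

/-- With w = M^(-n), points y within 2w of x carry mass at most 4 · 2^(-n) and contribute through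
the bound 2B. For the others, the Lipschitz constant C M^n times w² gives C w ≤ C 2^(-n). -/
theorem abs_conv_sub_le_of_scale (h : Admissible M α) {b : ℝ → ℝ} (hbm : Measurable b) {B C : ℝ}
    (hC0 : 0 ≤ C) (hB : ∀ x, |b x| ≤ B) (hb : ScaleLipschitz M C b) (n : ℕ) {x x' : ℝ}
    (hd : |x - x'| ≤ 1 / M ^ n * (1 / M ^ n)) :
    |conv b (cantorMeasure M) x - conv b (cantorMeasure M) x'| ≤ (C + 8 * B) * (1 / 2) ^ n := by
  classical
  have := isProbabilityMeasure_cantorMeasure h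
  have hM := h.lt_M
  have hMn : 0 < M ^ n := pow_pos h.M_pos n
  set w := 1 / M ^ n with hw
  have hw0 : 0 < w := one_div_pos.2 hMn
  have hMw : M ^ n * w = 1 := mul_one_div_cancel hMn.ne'
  have hw2 : w ≤ (1 / 2) ^ n := by
    rw [hw, one_div, one_div, inv_pow]
    gcongr
    linarith
  have hw1 : w ≤ 1 := hw2.trans (pow_le_one₀ (by norm_num) (by norm_num))
  have hB0 : 0 ≤ B := (abs_nonneg _).trans (hB 0)
  have hdw : |x - x'| ≤ w := hd.trans (mul_le_of_le_one_left hw0.le hw1)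
  -- Radius 2w rather than w: as x and x' are within w, any y outside stays at distance at least w
  -- from both, on the same side.
  set I := Set.Icc (x - 2 * w) (x + 2 * w) with hI
  have hpt : ∀ y, ‖b (x - y) - b (x' - y)‖ ≤ C * w + I.indicator (fun _ => 2 * B) y := by
    intro y
    rw [Real.norm_eq_abs]
    by_cases hy : y ∈ I
    · rw [Set.indicator_of_mem hy]
      have := abs_sub (b (x - y)) (b (x' - y))
      have := hB (x - y)
      have := hB (x' - y)
      have := mul_nonneg hC0 hw0.le
      linarith
    · rw [Set.indicator_of_notMem hy, add_zero]
      have hside : (1 ≤ M ^ n * (x - y) ∧ 1 ≤ M ^ n * (x' - y)) ∨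
          (M ^ n * (x - y) ≤ -1 ∧ M ^ n * (x' - y) ≤ -1) := by
        rw [abs_le] at hdw
        rw [hI, Set.mem_Icc, not_and_or, not_le, not_le] at hy
        rcases hy with hy | hy
        · left
          constructor <;> rw [← hMw] <;> gcongr <;> linarith
        · right
          constructor <;> rw [← hMw, ← mul_neg] <;> gcongr <;> linarith
      refine (hb n _ _ hside).trans ?_
      rw [sub_sub_sub_cancel_right]
      calc C * M ^ n * |x - x'| ≤ C * M ^ n * (w * w) := by gcongr
        _ = C * w * (M ^ n * w) := by ring
        _ = C * w := by rw [hMw, mul_one]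
  unfold conv
  rw [← integral_sub (integrable_conv h hbm hB x) (integrable_conv h hbm hB x'),
    ← Real.norm_eq_abs]
  have hint : Integrable (I.indicator fun _ => 2 * B) (cantorMeasure M) :=
    (integrable_const _).indicator measurableSet_Icc
  refine (norm_integral_le_of_norm_le ((integrable_const _).add hint) (ae_of_all _ hpt)).trans ?_
  rw [integral_add' (integrable_const _) hint, integral_indicator_const _ measurableSet_Icc]
  have hr := real_Icc_radius_le h n x
  rw [← hw] at hr
  simp only [integral_const, probReal_univ, smul_eq_mul]
  nlinarith [mul_le_mul_of_nonneg_right hr (by linarith : 0 ≤ 2 * B),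
    mul_le_mul_of_nonneg_left hw2 hC0]

/-- The Hölder exponent of the convolutions. -/
def holderExp (M : ℝ) : ℝ := Real.log 2 / (2 * Real.log M)

theorem holderExp_pos (h : Admissible M α) : 0 < holderExp M := by
  have := Real.log_pos (by linarith [h.lt_M] : 1 < M)
  have := Real.log_pos (by norm_num : (1 : ℝ) < 2)
  unfold holderExp
  positivity

theorem holderExp_le_one (h : Admissible M α) : holderExp M ≤ 1 := by
  have h1 := Real.log_pos (by linarith [h.lt_M] : 1 < M)
  have h2 := Real.log_le_log (by norm_num : (0 : ℝ) < 2) (by linarith [h.lt_M] : 2 ≤ M)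
  unfold holderExp
  rw [div_le_one (by positivity)]
  linarith

theorem rpow_holderExp (h : Admissible M α) :
    (1 / M * (1 / M)) ^ holderExp M = (1 / 2 : ℝ) := by
  have hM := h.M_pos
  have h1 := (Real.log_pos (by linarith [h.lt_M] : 1 < M)).ne'
  rw [Real.rpow_def_of_pos (by positivity), ← Real.exp_log (by norm_num : (0 : ℝ) < 1 / 2)]
  congr 1
  rw [Real.log_mul (by positivity) (by positivity), one_div, Real.log_inv, one_div, Real.log_inv,
    holderExp]
  field_simp
  ring

theorem abs_conv_sub_le (h : Admissible M α) {b : ℝ → ℝ} (hbm : Measurable b) {B C : ℝ}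
    (hC0 : 0 ≤ C) (hB : ∀ x, |b x| ≤ B) (hb : ScaleLipschitz M C b) {x x' : ℝ}
    (hd : |x - x'| ≤ 1) :
    |conv b (cantorMeasure M) x - conv b (cantorMeasure M) x'|
      ≤ 2 * (C + 8 * B) * |x - x'| ^ holderExp M := by
  have hM := h.lt_M
  have hB0 : 0 ≤ B := (abs_nonneg _).trans (hB 0)
  have hγ := holderExp_pos h
  rcases eq_or_ne x x' with rfl | hne
  · rw [sub_self, sub_self, abs_zero, Real.zero_rpow hγ.ne', mul_zero]
  have hpos : 0 < |x - x'| := abs_pos.2 (sub_ne_zero.2 hne)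
  have hy0 : 0 < 1 / M * (1 / M) := by have := h.M_pos; positivity
  have hM1 : 1 / M < 1 := (div_lt_one h.M_pos).2 (by linarith)
  have hy1 : 1 / M * (1 / M) < 1 := mul_lt_one_of_nonneg_of_lt_one_left
    (by have := h.M_pos; positivity) hM1 hM1.le
  -- The distance lies between M^(-2(n+1)) and M^(-2n). As M^(-2) to the power `holderExp` is 1/2,
  -- the bound 2^(-n) becomes twice a Hölder bound.
  obtain ⟨n, hn1, hn2⟩ := exists_nat_pow_near_of_lt_one hpos hd hy0 hy1
  rw [mul_pow, div_pow, one_pow] at hn2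
  refine (abs_conv_sub_le_of_scale h hbm hC0 hB hb n hn2).trans ?_
  have h1 : (1 / 2 : ℝ) ^ (n + 1) ≤ |x - x'| ^ holderExp M := by
    rw [← rpow_holderExp h, ← Real.rpow_natCast, ← Real.rpow_mul hy0.le, mul_comm (holderExp M),
      Real.rpow_mul hy0.le, Real.rpow_natCast]
    exact Real.rpow_le_rpow (by positivity) hn1.le hγ.le
  rw [pow_succ] at h1
  nlinarith

theorem continuous_conv (h : Admissible M α) {b : ℝ → ℝ} (hbm : Measurable b) {B C : ℝ}
    (hC0 : 0 ≤ C) (hB : ∀ x, |b x| ≤ B) (hb : ScaleLipschitz M C b) :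
    Continuous (conv b (cantorMeasure M)) := by
  rw [continuous_iff_continuousAt]
  intro x
  rw [ContinuousAt, tendsto_iff_norm_sub_tendsto_zero]
  have hev : ∀ᶠ y in 𝓝 x, |y - x| ≤ 1 := by
    filter_upwards [Metric.ball_mem_nhds x one_pos] with y hy
    rw [Metric.mem_ball, Real.dist_eq] at hy
    exact hy.le
  refine squeeze_zero' (Eventually.of_forall fun _ => norm_nonneg _)
    (hev.mono fun y hy => abs_conv_sub_le h hbm hC0 hB hb hy) ?_
  have hγ := holderExp_pos h
  have : Tendsto (fun y => 2 * (C + 8 * B) * |y - x| ^ holderExp M) (𝓝 x)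
      (𝓝 (2 * (C + 8 * B) * |x - x| ^ holderExp M)) := by
    apply Continuous.tendsto
    exact continuous_const.mul ((continuous_abs.comp (continuous_id.sub continuous_const)).rpow_const
      fun _ => Or.inr hγ.le)
  simpa [Real.zero_rpow hγ.ne'] using this

/-! ### The limit potential and its convolution with the Cantor measure -/

/-- The bounded part of the kernel. -/
def jump (M α x : ℝ) : ℝ := -(1 / (M - 2)) * Real.sign x - hatSum M α x + hatSum M α (-x)

theorem kernel_eq (x : ℝ) : kernel M α x = jump M α x + M / (M - 2) * x := by
  unfold kernel jump; ring

theorem measurable_jump (h : Admissible M α) : Measurable (jump M α) :=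
  ((measurable_sign.const_mul _).sub (measurable_hatSum h)).add
    ((measurable_hatSum h).comp measurable_neg)

theorem measurable_kernel (h : Admissible M α) : Measurable (kernel M α) := by
  have : kernel M α = fun x => jump M α x + M / (M - 2) * x := funext kernel_eq
  rw [this]
  exact (measurable_jump h).add (measurable_const_mul _)

theorem abs_jump_le (h : Admissible M α) (x : ℝ) : |jump M α x| ≤ 5 := by
  have hM := h.lt_M
  have h1 : |-(1 / (M - 2)) * Real.sign x| ≤ 1 := by
    rw [abs_mul, abs_neg, abs_of_pos (one_div_pos.2 (by linarith))]
    exact mul_le_one₀ ((div_le_one (by linarith)).2 (by linarith)) (abs_nonneg _) (abs_sign_le x)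
  have h2 := abs_hatSum_le h x
  have h3 := abs_hatSum_le h (-x)
  unfold jump
  rw [abs_le] at *
  constructor <;> linarith [h1.1, h1.2, h2.1, h2.2, h3.1, h3.2]

theorem scaleLipschitz_jump (h : Admissible M α) : ScaleLipschitz M 4 (jump M α) := by
  intro n s t hst
  have hMn : 0 < M ^ n := pow_pos h.M_pos n
  have h1 := scaleLipschitz_hatSum h n s t hst
  have h2 := scaleLipschitz_hatSum h n (-s) (-t) (by
    rw [mul_neg, mul_neg]
    rcases hst with ⟨hs, ht⟩ | ⟨hs, ht⟩
    · exact Or.inr ⟨by linarith, by linarith⟩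
    · exact Or.inl ⟨by linarith, by linarith⟩)
  have h3 : Real.sign s = Real.sign t := by
    rw [← sign_mul_of_pos hMn s, ← sign_mul_of_pos hMn t]
    rcases hst with ⟨hs, ht⟩ | ⟨hs, ht⟩
    · rw [Real.sign_of_pos (by linarith), Real.sign_of_pos (by linarith)]
    · rw [Real.sign_of_neg (by linarith), Real.sign_of_neg (by linarith)]
  have h4 : |-s - -t| = |s - t| := by rw [← abs_neg]; congr 1; ring
  rw [h4] at h2
  unfold jump
  rw [h3]
  rw [abs_le] at *
  constructor <;> linarith [h1.1, h1.2, h2.1, h2.2]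

theorem M_div_le (h : Admissible M α) : M / (M - 2) ≤ 2 :=
  (div_le_iff₀ (by linarith [h.lt_M])).2 (by linarith [h.lt_M])

theorem M_div_pos (h : Admissible M α) : 0 < M / (M - 2) :=
  div_pos h.M_pos (by linarith [h.lt_M])

theorem abs_kernel_le (h : Admissible M α) (x : ℝ) : |kernel M α x| ≤ 5 + 2 * |x| := by
  rw [kernel_eq]
  refine (abs_add_le _ _).trans (add_le_add (abs_jump_le h x) ?_)
  rw [abs_mul, abs_of_pos (M_div_pos h)]
  exact mul_le_mul_of_nonneg_right (M_div_le h) (abs_nonneg x)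

theorem continuousAt_kernel (h : Admissible M α) {x : ℝ} (hx : x ≠ 0) :
    ContinuousAt (kernel M α) x := by
  have : kernel M α = fun x => jump M α x + M / (M - 2) * x := funext kernel_eq
  rw [this]
  exact ((scaleLipschitz_jump h).continuousAt h hx).add (continuous_const_mul _).continuousAt

theorem kernel_neg (x : ℝ) : kernel M α (-x) = -kernel M α x := by
  unfold kernel
  rw [Real.sign_neg, neg_neg]
  ring

theorem intervalIntegrable_of_bounded {f : ℝ → ℝ} (hf : Measurable f) {C : ℝ}
    (hC : ∀ x, |f x| ≤ C) (a b : ℝ) : IntervalIntegrable f volume a b :=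
  (intervalIntegrable_const (c := C)).mono_fun' hf.aestronglyMeasurable (ae_of_all _ hC)

theorem intervalIntegrable_kernel (h : Admissible M α) (a b : ℝ) :
    IntervalIntegrable (kernel M α) volume a b := by
  have : kernel M α = fun x => jump M α x + M / (M - 2) * x := funext kernel_eq
  rw [this]
  exact (intervalIntegrable_of_bounded (measurable_jump h) (abs_jump_le h) a b).add
    (Continuous.intervalIntegrable (by fun_prop) a b)

theorem limitPotential_eq (h : Admissible M α) (c₀ x : ℝ) :
    limitPotential M α c₀ x = c₀ + ∫ t in (0 : ℝ)..x, kernel M α t := by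
  rw [limitPotential, limitDeriv_eq h]

theorem limitPotential_sub (h : Admissible M α) (c₀ a b : ℝ) :
    limitPotential M α c₀ a - limitPotential M α c₀ b = ∫ t in b..a, kernel M α t := by
  rw [limitPotential_eq h, limitPotential_eq h, add_sub_add_left_eq_sub,
    intervalIntegral.integral_interval_sub_left (intervalIntegrable_kernel h _ _)
      (intervalIntegrable_kernel h _ _)]

theorem hasDerivAt_limitPotential (h : Admissible M α) (c₀ : ℝ) {x : ℝ} (hx : x ≠ 0) :
    HasDerivAt (limitPotential M α c₀) (kernel M α x) x := by
  rw [show limitPotential M α c₀ = fun x => c₀ + ∫ t in (0 : ℝ)..x, kernel M α t from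
    funext (limitPotential_eq h c₀)]
  exact (intervalIntegral.integral_hasDerivAt_right (intervalIntegrable_kernel h _ _)
    (measurable_kernel h).stronglyMeasurable.stronglyMeasurableAtFilter
    (continuousAt_kernel h hx)).const_add c₀

theorem abs_limitPotential_sub_le (h : Admissible M α) (c₀ : ℝ) {R a b : ℝ} (ha : |a| ≤ R)
    (hb : |b| ≤ R) :
    |limitPotential M α c₀ a - limitPotential M α c₀ b| ≤ (5 + 2 * R) * |a - b| := by
  rw [limitPotential_sub h, ← Real.norm_eq_abs]
  refine intervalIntegral.norm_integral_le_of_norm_le_const fun x hx => ?_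
  rw [Real.norm_eq_abs]
  refine (abs_kernel_le h x).trans ?_
  have : |x| ≤ R := by
    rw [abs_le] at *
    rcases Set.mem_uIoc.1 hx with hx | hx
    · constructor <;> linarith [hx.1, hx.2, ha.1, ha.2, hb.1, hb.2]
    · constructor <;> linarith [hx.1, hx.2, ha.1, ha.2, hb.1, hb.2]
  linarith

theorem continuous_limitPotential (h : Admissible M α) (c₀ : ℝ) :
    Continuous (limitPotential M α c₀) := by
  rw [show limitPotential M α c₀ = fun x => c₀ + ∫ t in (0 : ℝ)..x, kernel M α t from
    funext (limitPotential_eq h c₀)]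
  exact continuous_const.add
    (intervalIntegral.continuous_primitive (intervalIntegrable_kernel h) 0)

theorem limitPotential_neg (h : Admissible M α) (c₀ x : ℝ) :
    limitPotential M α c₀ (-x) = limitPotential M α c₀ x := by
  rw [limitPotential_eq h, limitPotential_eq h]
  congr 1
  have h1 := intervalIntegral.integral_comp_neg (a := 0) (b := x) (kernel M α)
  simp only [kernel_neg, intervalIntegral.integral_neg, neg_zero] at h1
  rw [intervalIntegral.integral_symm (-x) 0]
  linarith

theorem integrable_limitPotential (h : Admissible M α) (c₀ x : ℝ) :
    Integrable (fun y => limitPotential M α c₀ (x - y)) (cantorMeasure M) := by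
  have hc : Continuous fun y => limitPotential M α c₀ (x - y) :=
    (continuous_limitPotential h c₀).comp (continuous_const.sub continuous_id)
  obtain ⟨C, hC⟩ := isCompact_Icc.exists_bound_of_continuousOn (s := Set.Icc (0 : ℝ) 1)
    hc.continuousOn
  exact integrable_of_bounded h hc.measurable hC

theorem integrable_kernel_and_hasDerivAt_conv (h : Admissible M α) (c₀ x : ℝ) :
    Integrable (fun y => kernel M α (x - y)) (cantorMeasure M) ∧
      HasDerivAt (conv (limitPotential M α c₀) (cantorMeasure M))
        (conv (kernel M α) (cantorMeasure M) x) x := by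
  have := isProbabilityMeasure_cantorMeasure h
  have hc := continuous_limitPotential h c₀
  refine hasDerivAt_integral_of_dominated_loc_of_lip (s := Metric.ball x 1)
    (F := fun x y => limitPotential M α c₀ (x - y)) (bound := fun _ => 5 + 2 * (|x| + 2))
    (Metric.ball_mem_nhds x one_pos)
    (Eventually.of_forall fun z => (integrable_limitPotential h c₀ z).aestronglyMeasurable)
    (integrable_limitPotential h c₀ x)
    (measurable_comp_sub (measurable_kernel h) x).aestronglyMeasurable ?_ (integrable_const _) ?_
  · filter_upwards [ae_mem_unit h] with y hy
    refine LipschitzOnWith.of_dist_le_mul fun a ha b hb => ?_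
    have key : ∀ z ∈ Metric.ball x 1, |z - y| ≤ |x| + 2 := by
      intro z hz
      rw [Metric.mem_ball, Real.dist_eq, abs_lt] at hz
      rw [abs_le]
      constructor <;> linarith [hz.1, hz.2, hy.1, hy.2, le_abs_self x, neg_abs_le x]
    rw [Real.dist_eq, Real.dist_eq, Real.coe_nnabs,
      abs_of_nonneg (by positivity : 0 ≤ 5 + 2 * (|x| + 2))]
    have := abs_limitPotential_sub_le h c₀ (key a ha) (key b hb)
    rwa [sub_sub_sub_cancel_right] at this
  · have hne : ∀ᵐ y ∂(cantorMeasure M), y ≠ x := by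
      rw [ae_iff]
      simpa using noAtoms_cantorMeasure h x
    filter_upwards [hne] with y hy
    exact (hasDerivAt_limitPotential h c₀ (sub_ne_zero.2 hy.symm)).comp_sub_const x y

theorem conv_limitPotential_reflect (h : Admissible M α) (c₀ x : ℝ) :
    conv (limitPotential M α c₀) (cantorMeasure M) (1 - x)
      = conv (limitPotential M α c₀) (cantorMeasure M) x := by
  unfold conv
  rw [← integral_reflect h (measurable_comp_sub (continuous_limitPotential h c₀).measurable x)]
  congr 1
  ext y
  rw [← limitPotential_neg h]
  congr 1
  ring

theorem conv_kernel_eq_jump (h : Admissible M α) (x : ℝ) :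
    conv (kernel M α) (cantorMeasure M) x
      = conv (jump M α) (cantorMeasure M) x + M / (M - 2) * (x - 1 / 2) := by
  have := isProbabilityMeasure_cantorMeasure h
  have hlin : Integrable (fun y => M / (M - 2) * (x - y)) (cantorMeasure M) :=
    ((integrable_const x).sub (integrable_id h)).const_mul _
  unfold conv
  simp only [kernel_eq]
  rw [integral_add (integrable_conv h (measurable_jump h) (abs_jump_le h) x) hlin,
    integral_const_mul,
    integral_sub (integrable_const x) (integrable_id h), integral_id h]
  simp

/-- Symmetry of the measure turns the reflected tents into the same average at 1 - x, so a single
function describes both sides. -/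
theorem conv_jump_eq (h : Admissible M α) (x : ℝ) :
    conv (jump M α) (cantorMeasure M) x
      = -(1 / (M - 2)) * conv Real.sign (cantorMeasure M) x
        - conv (hatSum M α) (cantorMeasure M) x
        + conv (hatSum M α) (cantorMeasure M) (1 - x) := by
  have := isProbabilityMeasure_cantorMeasure h
  have h1 : conv (hatSum M α) (cantorMeasure M) (1 - x)
      = ∫ y, hatSum M α (-(x - y)) ∂(cantorMeasure M) := by
    unfold conv
    rw [← integral_reflect h (measurable_comp_sub (measurable_hatSum h) (1 - x))]
    congr 1
    ext y
    congr 1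
    ring
  have hs : Integrable (fun y => -(1 / (M - 2)) * Real.sign (x - y)) (cantorMeasure M) :=
    (integrable_conv h measurable_sign abs_sign_le x).const_mul _
  have hp := integrable_conv h (measurable_hatSum h) (abs_hatSum_le h) x
  have hn : Integrable (fun y => hatSum M α (-(x - y))) (cantorMeasure M) :=
    integrable_conv h ((measurable_hatSum h).comp measurable_neg) (fun x => abs_hatSum_le h (-x)) x
  have hsp : Integrable (fun y => -(1 / (M - 2)) * Real.sign (x - y) - hatSum M α (x - y))
    (cantorMeasure M) := hs.sub hp
  rw [h1]
  unfold conv jump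
  rw [← integral_const_mul, ← integral_sub hs hp, ← integral_add hsp hn]

theorem conv_kernel_eq (h : Admissible M α) (x : ℝ) :
    conv (kernel M α) (cantorMeasure M) x
      = -(1 / (M - 2)) * conv Real.sign (cantorMeasure M) x + M / (M - 2) * (x - 1 / 2)
        - conv (hatSum M α) (cantorMeasure M) x
        + conv (hatSum M α) (cantorMeasure M) (1 - x) := by
  rw [conv_kernel_eq_jump h, conv_jump_eq h]
  ring

theorem continuous_conv_hatSum (h : Admissible M α) :
    Continuous (conv (hatSum M α) (cantorMeasure M)) :=
  continuous_conv h (measurable_hatSum h) zero_le_two (abs_hatSum_le h) (scaleLipschitz_hatSum h)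

theorem continuous_conv_kernel (h : Admissible M α) :
    Continuous (conv (kernel M α) (cantorMeasure M)) := by
  rw [show conv (kernel M α) (cantorMeasure M) = _ from funext (conv_kernel_eq_jump h)]
  have := continuous_conv h (measurable_jump h) (by norm_num) (abs_jump_le h)
    (scaleLipschitz_jump h)
  fun_prop

theorem deriv_conv_limitPotential (h : Admissible M α) (c₀ : ℝ) :
    deriv (conv (limitPotential M α c₀) (cantorMeasure M))
      = conv (kernel M α) (cantorMeasure M) :=
  funext fun x => (integrable_kernel_and_hasDerivAt_conv h c₀ x).2.deriv

theorem abs_conv_jump_sub_le (h : Admissible M α) (x x' : ℝ) :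
    |conv (jump M α) (cantorMeasure M) x - conv (jump M α) (cantorMeasure M) x'|
      ≤ 88 * |x - x'| ^ holderExp M := by
  -- The constant is 88 = 2(4 + 8 · 5). At distances above 1 the trivial bound 10 is enough.
  rcases le_or_gt |x - x'| 1 with hd | hd
  · refine (abs_conv_sub_le h (measurable_jump h) (by norm_num) (abs_jump_le h)
      (scaleLipschitz_jump h) hd).trans_eq ?_
    norm_num
  · have := isProbabilityMeasure_cantorMeasure h
    have hb : ∀ z, |conv (jump M α) (cantorMeasure M) z| ≤ 5 := fun z => by
      rw [← Real.norm_eq_abs]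
      exact (norm_integral_le_of_norm_le_const
        (ae_of_all _ fun y => abs_jump_le h (z - y))).trans (by simp)
    have h1 := Real.one_le_rpow hd.le (holderExp_pos h).le
    have h2 := abs_sub (conv (jump M α) (cantorMeasure M) x) (conv (jump M α) (cantorMeasure M) x')
    linarith [hb x, hb x']

theorem c1HolderLoc_conv (h : Admissible M α) (c₀ : ℝ) :
    C1HolderLoc (holderExp M).toNNReal
      (conv (limitPotential M α c₀) (cantorMeasure M)) := by
  have hγ := holderExp_pos h
  have hγ1 := holderExp_le_one h
  refine ⟨contDiff_one_iff_deriv.2 ⟨fun x =>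
    (integrable_kernel_and_hasDerivAt_conv h c₀ x).2.differentiableAt, ?_⟩, fun K hK => ?_⟩
  · rw [deriv_conv_limitPotential h]
    exact continuous_conv_kernel h
  rw [deriv_conv_limitPotential h]
  obtain ⟨D, hD⟩ := Metric.isBounded_iff.1 hK.isBounded
  have hD' : ∀ x ∈ K, ∀ y ∈ K, |x - y| ≤ max D 1 := fun x hx y hy =>
    (hD hx hy).trans (le_max_left _ _)
  have hD1 : 1 ≤ max D 1 := le_max_right _ _
  set R := max D 1
  refine ⟨(88 + 2 * R).toNNReal, fun x hx y hy => ?_⟩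
  rw [edist_dist, edist_dist, Real.coe_toNNReal _ hγ.le, ENNReal.ofReal_rpow_of_nonneg dist_nonneg
    hγ.le, ENNReal.ofNNReal_toNNReal, ← ENNReal.ofReal_mul (by linarith)]
  apply ENNReal.ofReal_le_ofReal
  rw [Real.dist_eq, Real.dist_eq, conv_kernel_eq_jump h, conv_kernel_eq_jump h,
    add_sub_add_comm, ← mul_sub, sub_sub_sub_cancel_right, add_mul]
  refine (abs_add_le _ _).trans (add_le_add (abs_conv_jump_sub_le h x y) ?_)
  rw [abs_mul, abs_of_pos (M_div_pos h), mul_assoc]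
  refine mul_le_mul (M_div_le h) ?_ (abs_nonneg _) zero_le_two
  have hxy := hD' x hx y hy
  rcases le_or_gt |x - y| 1 with h1 | h1
  · have h2 := Real.rpow_le_rpow_of_exponent_ge' (abs_nonneg (x - y)) h1 hγ.le hγ1
    rw [Real.rpow_one] at h2
    have := Real.rpow_nonneg (abs_nonneg (x - y)) (holderExp M)
    nlinarith
  · have h2 := Real.one_le_rpow h1.le hγ.le
    nlinarith

/-! ### The force in the gaps of the Cantor set -/

/-- The average of the tent function against the Cantor measure. -/
def hatAvg (M α : ℝ) : ℝ → ℝ := conv (hat M α) (cantorMeasure M)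

/-- The average of the sum of rescaled tents against the Cantor measure. -/
def hatSumAvg (M α : ℝ) : ℝ → ℝ := conv (hatSum M α) (cantorMeasure M)

/-- The convolution of the limit potential with the Cantor measure. -/
def potential (M α c₀ : ℝ) : ℝ → ℝ := conv (limitPotential M α c₀) (cantorMeasure M)

/-- The convolution of the derivative of the limit potential with the Cantor measure. -/
def force (M α : ℝ) : ℝ → ℝ := conv (kernel M α) (cantorMeasure M)

theorem conv_sign_of_gt_one (h : Admissible M α) {x : ℝ} (hx : 1 < x) :
    conv Real.sign (cantorMeasure M) x = 1 := by
  rw [conv_eq_affine h 1 0 fun y hy => by rw [Real.sign_of_pos (by linarith [hy.2])]; ring]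
  ring

theorem conv_sign_of_neg (h : Admissible M α) {x : ℝ} (hx : x < 0) :
    conv Real.sign (cantorMeasure M) x = -1 := by
  rw [conv_eq_affine h (-1) 0 fun y hy => by rw [Real.sign_of_neg (by linarith [hy.1])]; ring]
  ring

theorem hatSumAvg_of_nonpos (h : Admissible M α) {x : ℝ} (hx : x ≤ 0) : hatSumAvg M α x = 0 := by
  rw [hatSumAvg, conv_eq_affine h 0 0 fun y hy => by
    rw [hatSum_of_nonpos h (by linarith [hy.1])]; ring]
  ring

theorem hatSumAvg_of_two_le (h : Admissible M α) {x : ℝ} (hx : 2 ≤ x) : hatSumAvg M α x = 0 := by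
  rw [hatSumAvg, conv_eq_affine h 0 0 fun y hy => by
    rw [hatSum_of_one_le h (by linarith [hy.2])]; ring]
  ring

theorem hatSumAvg_le_two (h : Admissible M α) (x : ℝ) : hatSumAvg M α x ≤ 2 :=
  (conv_le_affine h (measurable_hatSum h) (abs_hatSum_le h) 2 0 fun y _ => by
    linarith [hatSum_le_two h (x - y)]).trans_eq (by ring)

theorem hatAvg_of_le (h : Admissible M α) {x : ℝ} (hx : x ≤ M - α) : hatAvg M α x = 0 := by
  rw [hatAvg, conv_eq_affine h 0 0 fun y hy => by
    rw [hat_eq_zero_of_le h (by linarith [hy.1])]; ring]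
  ring

theorem hatAvg_of_ge (h : Admissible M α) {x : ℝ} (hx : M + 1 ≤ x) : hatAvg M α x = 0 := by
  rw [hatAvg, conv_eq_affine h 0 0 fun y hy => by
    rw [hat_eq_zero_of_ge (by linarith [hy.2])]; ring]
  ring

theorem hatAvg_le_two (h : Admissible M α) (x : ℝ) : hatAvg M α x ≤ 2 :=
  (conv_le_affine h continuous_hat.measurable (abs_hat_le h) 2 0 fun y _ => by
    linarith [hat_le_two h (x - y)]).trans_eq (by ring)

theorem hatAvg_nonneg (x : ℝ) : 0 ≤ hatAvg M α x :=
  integral_nonneg fun y => hat_nonneg (x - y)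

theorem hatAvg_le_half (h : Admissible M α) {x : ℝ} (hx : M ≤ x) : hatAvg M α x ≤ 1 / 2 := by
  refine (conv_le_affine h continuous_hat.measurable (abs_hat_le h) 0 1 fun y hy => ?_).trans_eq
    (by ring)
  exact max_le (by linarith [hy.1]) ((min_le_right _ _).trans (by linarith))

/-- Only the falling side, of slope -1, is sampled; the mean of the measure is 1/2. -/
theorem hatAvg_sub (h : Admissible M α) {u : ℝ} (h0 : 0 ≤ u) (h1 : u ≤ 1) :
    hatAvg M α (M - u) = u + 1 / 2 := by
  rw [hatAvg, conv_eq_affine h u 1 fun y hy => by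
    rw [hat_of_falling h (by linarith [hy.2]) (by linarith [hy.1])]; ring]

/-- Near its peak the tent is concave, so it lies above its chord between y = 0 (value 1 + s) and y
= 1 (value 2 - δs). Averaging the chord gives 3/2 + (1 - δ)s/2. -/
theorem hatAvg_ge_three_halves (h : Admissible M α) {s : ℝ} (h0 : 0 ≤ s) (h1 : s ≤ 1) :
    3 / 2 ≤ hatAvg M α (M - 1 - s) := by
  have hδ := h.slope_pos
  have hδ' := h.slope_lt
  have hδ2 := h.slope_mul
  set δ := 2 / (α - 2) with hδ_def
  have key : (1 + s) + (1 - s - δ * s) / 2 ≤ hatAvg M α (M - 1 - s) := by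
    refine conv_ge_affine h continuous_hat.measurable (abs_hat_le h) _ _ fun y hy => ?_
    have hsy : 0 ≤ s * y := mul_nonneg h0 hy.1
    have hsy' : 0 ≤ (1 - s) * (1 - y) := mul_nonneg (by linarith) (by linarith [hy.2])
    refine le_max_of_le_right (le_min ?_ ?_)
    · rw [← hδ_def]
      have e : δ * (M - 1 - s - y - (M - α)) = δ * (α - 2) + δ * (1 - s - y) := by ring
      rw [e, hδ2]
      nlinarith [mul_nonneg hδ.le hsy']
    · nlinarith [mul_nonneg hδ.le hsy]
  nlinarith

theorem hatAvg_ge_affine (h : Admissible M α) {s : ℝ} (h1 : 1 ≤ s) :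
    2 + 2 / (α - 2) * (1 / 2 - s) ≤ hatAvg M α (M - 1 - s) := by
  have hδ := h.slope_pos
  have hδ2 := h.slope_mul
  set δ := 2 / (α - 2) with hδ_def
  have key : (2 + δ * (1 - s)) + (-δ) / 2 ≤ hatAvg M α (M - 1 - s) := by
    refine conv_ge_affine h continuous_hat.measurable (abs_hat_le h) _ _ fun y hy => ?_
    refine le_max_of_le_right (le_min ?_ ?_)
    · rw [← hδ_def]
      have e : δ * (M - 1 - s - y - (M - α)) = δ * (α - 2) + δ * (1 - s - y) := by ring
      rw [e, hδ2]
      linarith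
    · nlinarith [mul_nonneg hδ.le (by linarith [hy.1] : 0 ≤ s - 1 + y), hy.1]
  linarith

theorem hatSumAvg_rec (h : Admissible M α) (x : ℝ) :
    hatSumAvg M α x = 1 / 2 * (hatAvg M α (M * x) + hatSumAvg M α (M * x))
      + 1 / 2 * (hatAvg M α (M * x - (M - 1)) + hatSumAvg M α (M * x - (M - 1))) :=
  conv_hatSum_rec h x

theorem one_div_mul_sub (h : Admissible M α) : 1 / (M - 2) * (M - 2) = 1 :=
  one_div_mul_cancel (by linarith [h.lt_M])

theorem force_eq (h : Admissible M α) (x : ℝ) :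
    force M α x = 1 / (M - 2) * (M * x - M / 2 - conv Real.sign (cantorMeasure M) x)
      - hatSumAvg M α x + hatSumAvg M α (1 - x) := by
  rw [force, conv_kernel_eq h, hatSumAvg]
  ring

/-- With u = Mx, the affine and sign terms alone miss the scaling by -(u + 1/2)/2, because (1 -
M/2)/(M - 2) = -1/2. The falling side of the coarsest tent, seen from 1 - x, contributes exactly (u
+ 1/2)/2; the finer tents scale by themselves. -/
theorem force_self_similar (h : Admissible M α) {x : ℝ} (h0 : 0 < x) (h1 : M * x < 1) :
    force M α x = force M α (M * x) / 2 := by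
  have hM := h.lt_M
  have hu := h.upper
  have hu0 : 0 < M * x := mul_pos h.M_pos h0
  rw [force_eq h, force_eq h, conv_sign_rec h x, hatSumAvg_rec h x, hatSumAvg_rec h (1 - x)]
  set u := M * x with hu_def
  have e1 : M * (1 - x) = M - u := by rw [hu_def]; ring
  have e2 : M - u - (M - 1) = 1 - u := by ring
  rw [e1, e2, conv_sign_of_neg h (x := u - (M - 1)) (by linarith),
    hatSumAvg_of_nonpos h (x := u - (M - 1)) (by linarith), hatAvg_of_le h (x := u) (by linarith),
    hatAvg_of_le h (x := u - (M - 1)) (by linarith), hatAvg_of_le h (x := 1 - u) (by linarith),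
    hatSumAvg_of_two_le h (x := M - u) (by linarith), hatAvg_sub h hu0.le h1.le]
  linear_combination (-(1 / 4) - u / 2) * one_div_mul_sub h

/-- This covers the left half of the middle gap, which suffices by reflection. -/
theorem force_gap (h : Admissible M α) {s : ℝ} (h0 : 0 < s) (h1 : s ≤ M / 2 - 1) :
    force M α ((1 + s) / M)
      = 1 / (M - 2) * (1 + s - M / 2) - hatSumAvg M α (1 + s) / 2 + hatAvg M α (M - 1 - s) / 2 := by
  have hM := h.lt_M
  have hu := h.upper
  rw [force_eq h, conv_sign_rec h ((1 + s) / M), hatSumAvg_rec h ((1 + s) / M),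
    hatSumAvg_rec h (1 - (1 + s) / M)]
  have e1 : M * ((1 + s) / M) = 1 + s := mul_div_cancel₀ _ h.M_pos.ne'
  have e2 : M * (1 - (1 + s) / M) = M - 1 - s := by rw [mul_sub, e1]; ring
  have e3 : M - 1 - s - (M - 1) = -s := by ring
  rw [e1, e2, e3, conv_sign_of_gt_one h (x := 1 + s) (by linarith),
    conv_sign_of_neg h (x := 1 + s - (M - 1)) (by linarith),
    hatAvg_of_le h (x := 1 + s) (by linarith),
    hatAvg_of_le h (x := 1 + s - (M - 1)) (by linarith),
    hatSumAvg_of_nonpos h (x := 1 + s - (M - 1)) (by linarith),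
    hatSumAvg_of_two_le h (x := M - 1 - s) (by linarith),
    hatAvg_of_le h (x := -s) (by linarith), hatSumAvg_of_nonpos h (x := -s) (by linarith)]
  ring

theorem force_outside (h : Admissible M α) {s : ℝ} (h0 : 0 < s) :
    force M α (1 + s) = 1 / 2 + 1 / (M - 2) * M * s - hatSumAvg M α (1 + s) := by
  rw [force_eq h, conv_sign_of_gt_one h (by linarith),
    hatSumAvg_of_nonpos h (x := 1 - (1 + s)) (by linarith)]
  linear_combination (1 / 2) * one_div_mul_sub h

/-! ### The primitive of the averaged tents to the right of the Cantor set -/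

theorem hatSumAvg_near_one (h : Admissible M α) {s : ℝ} (h0 : 0 ≤ s) (h1 : M * s ≤ 1) :
    hatSumAvg M α (1 + s) ≤ 1 / 4 + 1 / 2 * hatSumAvg M α (1 + M * s) := by
  have hM := h.lt_M
  have hu := h.upper
  have hs : 0 ≤ M * s := mul_nonneg h.M_pos.le h0
  have e1 : M * (1 + s) = M + M * s := by ring
  have e2 : M + M * s - (M - 1) = 1 + M * s := by ring
  rw [hatSumAvg_rec h (1 + s), e1, e2, hatSumAvg_of_two_le h (x := M + M * s) (by linarith),
    hatAvg_of_le h (x := 1 + M * s) (by linarith)]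
  linarith [hatAvg_le_half h (x := M + M * s) (by linarith)]

theorem hatSumAvg_away (h : Admissible M α) {s : ℝ} (h1 : 1 ≤ M * s) :
    hatSumAvg M α (1 + s) = hatAvg M α (1 + M * s) / 2 := by
  have hM := h.lt_M
  have e1 : M * (1 + s) = M + M * s := by ring
  have e2 : M + M * s - (M - 1) = 1 + M * s := by ring
  rw [hatSumAvg_rec h (1 + s), e1, e2, hatSumAvg_of_two_le h (x := M + M * s) (by linarith),
    hatAvg_of_ge h (x := M + M * s) (by linarith),
    hatSumAvg_of_two_le h (x := 1 + M * s) (by linarith)]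
  ring

/-- The primitive of `hatSumAvg` starting at `1`. -/
def tailPrimitive (M α s : ℝ) : ℝ := ∫ t in (0 : ℝ)..s, hatSumAvg M α (1 + t)

theorem continuous_hatSumAvg_add (h : Admissible M α) :
    Continuous fun t => hatSumAvg M α (1 + t) :=
  (continuous_conv_hatSum h).comp (continuous_const.add continuous_id)

theorem hasDerivAt_tailPrimitive (h : Admissible M α) (s : ℝ) :
    HasDerivAt (tailPrimitive M α) (hatSumAvg M α (1 + s)) s :=
  ((continuous_hatSumAvg_add h).integral_hasStrictDerivAt 0 s).hasDerivAt

theorem tailPrimitive_sub_le (h : Admissible M α) {a b C : ℝ} (hab : a ≤ b)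
    (hC : ∀ t ∈ Set.Icc a b, hatSumAvg M α (1 + t) ≤ C) :
    tailPrimitive M α b - tailPrimitive M α a ≤ C * (b - a) := by
  have hc := continuous_hatSumAvg_add h
  unfold tailPrimitive
  rw [intervalIntegral.integral_interval_sub_left (hc.intervalIntegrable _ _)
    (hc.intervalIntegrable _ _)]
  refine (intervalIntegral.integral_mono_on hab (hc.intervalIntegrable _ _)
    intervalIntegrable_const hC).trans_eq ?_
  rw [intervalIntegral.integral_const, smul_eq_mul, mul_comm]

theorem tailPrimitive_zero : tailPrimitive M α 0 = 0 := intervalIntegral.integral_same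

theorem tailPrimitive_rec (h : Admissible M α) {s : ℝ} (h0 : 0 ≤ s) (h1 : M * s ≤ 1) :
    tailPrimitive M α s ≤ s / 4 + 1 / M / 2 * tailPrimitive M α (M * s) := by
  have hc := continuous_hatSumAvg_add h
  have hcM : Continuous fun t => hatSumAvg M α (1 + M * t) :=
    hc.comp (continuous_const_mul M)
  have h2 : tailPrimitive M α s ≤ ∫ t in (0 : ℝ)..s, (1 / 4 + 1 / 2 * hatSumAvg M α (1 + M * t)) := by
    refine intervalIntegral.integral_mono_on h0 (hc.intervalIntegrable _ _)
      (Continuous.intervalIntegrable (by fun_prop) _ _) fun t ht => ?_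
    exact hatSumAvg_near_one h ht.1 ((mul_le_mul_of_nonneg_left ht.2 h.M_pos.le).trans h1)
  refine h2.trans_eq ?_
  rw [intervalIntegral.integral_add intervalIntegrable_const
    ((hcM.intervalIntegrable _ _).const_mul _), intervalIntegral.integral_const_mul,
    intervalIntegral.integral_comp_mul_left (fun t => hatSumAvg M α (1 + t)) h.M_pos.ne',
    intervalIntegral.integral_const, tailPrimitive, mul_zero]
  simp only [smul_eq_mul]
  ring

/-- The pointwise bound 1/2 on the integrand is not available, but its integral obeys T(s) ≤ s/4 +
T(Ms)/(2M), which preserves T(s) ≤ s/2. It remains to treat the scale [1/M, 1]. -/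
theorem tailPrimitive_le (h : Admissible M α) {s : ℝ} (h0 : 0 ≤ s) (h1 : s ≤ 1) :
    tailPrimitive M α s ≤ s / 2 := by
  have hM := h.lt_M
  have hM0 := h.M_pos
  have hu := h.upper
  set w := 1 / M with hw
  have hw0 : 0 < w := one_div_pos.2 hM0
  have hMw : M * w = 1 := mul_one_div_cancel hM0.ne'
  have hw1 : w < 1 / 70 := one_div_lt_one_div_of_lt (by norm_num) hM
  have hαw : α * w ≤ 2 / 5 - 4 * w := by
    have := mul_le_mul_of_nonneg_right hu hw0.le
    linarith
  -- From 1 + M s₁ = M - α: up to s₁ the coarsest averaged tent has not yet begun.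
  set s₁ := 1 - (α + 1) * w with hs₁
  have hs1 : w ≤ s₁ := by rw [hs₁]; linarith
  have hflat : ∀ t, w ≤ t → t ≤ s₁ → hatSumAvg M α (1 + t) ≤ 0 := by
    intro t ht1 ht2
    have h2 := mul_le_mul_of_nonneg_left ht1 hM0.le
    have h3 := mul_le_mul_of_nonneg_left ht2 hM0.le
    have h4 : M * s₁ = M - (α + 1) := by rw [hs₁]; linear_combination (-(α + 1)) * hMw
    rw [hatSumAvg_away h (by linarith), hatAvg_of_le h (by linarith), zero_div]
  have hdip : ∀ t, w ≤ t → hatSumAvg M α (1 + t) ≤ 1 := by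
    intro t ht1
    have h2 := mul_le_mul_of_nonneg_left ht1 hM0.le
    rw [hatSumAvg_away h (by linarith)]
    linarith [hatAvg_le_two h (1 + M * t)]
  have h2 : tailPrimitive M α s₁ - tailPrimitive M α w ≤ 0 * (s₁ - w) :=
    tailPrimitive_sub_le h hs1 fun t ht => hflat t ht.1 ht.2
  have hs1' : s₁ ≤ 1 := by
    rw [hs₁]; linarith [mul_pos (by linarith [h.lt_alpha] : 0 < α + 1) hw0]
  have h3 : tailPrimitive M α 1 - tailPrimitive M α s₁ ≤ 1 * (1 - s₁) :=
    tailPrimitive_sub_le h hs1' fun t ht => hdip t (hs1.trans ht.1)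
  -- Bootstrap: T(1) ≤ 2 gives T(w) ≤ 5w/4; then T(1) ≤ 5w/4 + (α + 1)w ≤ 1/2 by the upper bound on
  -- α, which improves the former to T(w) ≤ w/2.
  have h4 := tailPrimitive_sub_le h zero_le_one fun t _ => hatSumAvg_le_two h (1 + t)
  have h5 := tailPrimitive_rec h hw0.le hMw.le
  rw [hMw, ← hw] at h5
  rw [tailPrimitive_zero] at h4
  have h6 : tailPrimitive M α w ≤ 5 / 4 * w := by nlinarith
  have h7 : tailPrimitive M α 1 ≤ 1 / 2 := by linarith
  have h8 : tailPrimitive M α w ≤ w / 2 := by nlinarith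
  have hlarge : ∀ t, w ≤ t → t ≤ 1 → tailPrimitive M α t ≤ t / 2 := by
    intro t ht1 ht2
    rcases le_total t s₁ with ht3 | ht3
    · have := tailPrimitive_sub_le h ht1 fun r hr => hflat r hr.1 (hr.2.trans ht3)
      linarith
    · have := tailPrimitive_sub_le h ht3 fun r hr => hdip r (hs1.trans hr.1)
      linarith
  rcases eq_or_lt_of_le h0 with rfl | hpos
  · rw [tailPrimitive_zero, zero_div]
  obtain ⟨n, hn⟩ := h.exists_one_le_pow_mul hpos
  induction n generalizing s with
  | zero => exact hlarge s (by linarith) h1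
  | succ n ih =>
    rcases le_or_gt w s with hs | hs
    · exact hlarge s hs h1
    · have hMs : M * s ≤ 1 := by
        have := mul_le_mul_of_nonneg_left hs.le hM0.le
        linarith
      have h9 := tailPrimitive_rec h h0 hMs
      have h10 := ih (s := M * s) (by positivity) hMs (by positivity)
        (by rwa [← mul_assoc, ← pow_succ])
      rw [← hw] at h9
      have h11 := mul_le_mul_of_nonneg_left h10 (by linarith : 0 ≤ w / 2)
      have e : w / 2 * (M * s / 2) = (M * w) * s / 4 := by ring
      rw [e, hMw] at h11
      linarith

/-! ### The potential is minimal exactly on the Cantor set -/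

theorem le_of_hasDerivAt_nonneg {f f' : ℝ → ℝ} {a b : ℝ} (hab : a ≤ b)
    (hf : ∀ x, HasDerivAt f (f' x) x) (hf' : ∀ x, a < x → x < b → 0 ≤ f' x) : f a ≤ f b := by
  refine monotoneOn_of_deriv_nonneg (convex_Icc a b)
    (fun x _ => (hf x).continuousAt.continuousWithinAt)
    (fun x _ => (hf x).differentiableAt.differentiableWithinAt) (fun x hx => ?_)
    (Set.left_mem_Icc.2 hab) (Set.right_mem_Icc.2 hab) hab
  rw [interior_Icc] at hx
  rw [(hf x).deriv]
  exact hf' x hx.1 hx.2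

theorem hasDerivAt_potential (h : Admissible M α) (c₀ x : ℝ) :
    HasDerivAt (potential M α c₀) (force M α x) x :=
  (integrable_kernel_and_hasDerivAt_conv h c₀ x).2

theorem potential_reflect (h : Admissible M α) (c₀ x : ℝ) :
    potential M α c₀ (1 - x) = potential M α c₀ x :=
  conv_limitPotential_reflect h c₀ x

/-- Integrated form of F(x) = F(Mx)/2: the change of variables supplies the further factor 1/M. -/
theorem potential_left (h : Admissible M α) (c₀ : ℝ) {x : ℝ} (h0 : 0 ≤ x) (h1 : M * x ≤ 1) :
    potential M α c₀ x - potential M α c₀ 0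
      = 1 / M / 2 * (potential M α c₀ (M * x) - potential M α c₀ 0) := by
  have hM := h.M_pos
  set f := fun t => potential M α c₀ t - 1 / M / 2 * potential M α c₀ (M * t) with hf_def
  set f' := fun t => force M α t - 1 / M / 2 * (force M α (M * t) * (M * 1)) with hf'_def
  have hf : ∀ t, HasDerivAt f (f' t) t := fun t =>
    (hasDerivAt_potential h c₀ t).sub
      ((((hasDerivAt_potential h c₀ (M * t)).comp t ((hasDerivAt_id t).const_mul M))).const_mul _)
  have hf' : ∀ t, 0 < t → t < x → f' t = 0 := by
    intro t ht0 htx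
    have hMt : M * t < 1 := (mul_lt_mul_of_pos_left htx hM).trans_le h1
    rw [hf'_def]
    simp only
    rw [force_self_similar h ht0 hMt]
    field_simp
    ring
  have h2 := le_of_hasDerivAt_nonneg h0 hf fun t ht0 htx => (hf' t ht0 htx).ge
  have h3 := le_of_hasDerivAt_nonneg h0 (fun t => (hf t).neg) fun t ht0 htx => by
    rw [hf' t ht0 htx, neg_zero]
  simp only [hf_def, Pi.neg_apply, mul_zero] at h2 h3
  linarith

theorem potential_right (h : Admissible M α) (c₀ : ℝ) {x : ℝ} (h0 : M - 1 ≤ M * x) (h1 : x ≤ 1) :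
    potential M α c₀ x - potential M α c₀ 0
      = 1 / M / 2 * (potential M α c₀ (M * x - (M - 1)) - potential M α c₀ 0) := by
  rw [← potential_reflect h c₀ x, ← potential_reflect h c₀ (M * x - (M - 1)),
    potential_left h c₀ (x := 1 - x) (by linarith) (by linarith)]
  congr 4
  ring

theorem potential_one_div (h : Admissible M α) (c₀ : ℝ) :
    potential M α c₀ (1 / M) = potential M α c₀ 0 := by
  have hM := h.M_pos
  have e : M * (1 / M) = 1 := mul_one_div_cancel hM.ne'
  have h1 := potential_left h c₀ (x := 1 / M) (by positivity) e.le
  rw [e, show (1 : ℝ) = 1 - 0 by ring, potential_reflect h] at h1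
  simp only [sub_zero, sub_self, mul_zero] at h1
  linarith

/-! ### Strict inequality in the middle gap and outside [0,1]. -/

theorem hasDerivAt_quadratic (a b s : ℝ) :
    HasDerivAt (fun s : ℝ => a * s ^ 2 + b * s) (2 * a * s + b) s := by
  have := ((hasDerivAt_pow 2 s).const_mul a).add ((hasDerivAt_id s).const_mul b)
  refine this.congr_deriv ?_
  simp
  ring

theorem hasDerivAt_potential_gap (h : Admissible M α) (c₀ s : ℝ) :
    HasDerivAt (fun s => M * potential M α c₀ ((1 + s) / M)) (force M α ((1 + s) / M)) s := by
  have h1 := ((hasDerivAt_potential h c₀ ((1 + s) / M)).comp s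
    (((hasDerivAt_id s).const_add 1).div_const M)).const_mul M
  refine h1.congr_deriv ?_
  have := h.M_pos.ne'
  field_simp

theorem one_div_M_sub_pos (h : Admissible M α) : 0 < 1 / (M - 2) :=
  one_div_pos.2 (by linarith [h.lt_M])

/-- With q = 1/(M-2), the force is at least qs + 1/4 minus half the averaged finer tents. Their
primitive is at most s/2, so the linear terms cancel and qs²/2 > 0 is left. -/
theorem potential_gap_near (h : Admissible M α) (c₀ : ℝ) {s : ℝ} (h0 : 0 < s) (h1 : s ≤ 1) :
    potential M α c₀ 0 < potential M α c₀ ((1 + s) / M) := by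
  have hM := h.lt_M
  have hq := one_div_M_sub_pos h
  have hqM := one_div_mul_sub h
  set q := 1 / (M - 2)
  have hd : ∀ t, HasDerivAt (fun s => M * potential M α c₀ ((1 + s) / M)
      - (q / 2 * s ^ 2 + 1 / 4 * s) + 1 / 2 * tailPrimitive M α s)
      (force M α ((1 + t) / M) - (2 * (q / 2) * t + 1 / 4) + 1 / 2 * hatSumAvg M α (1 + t)) t :=
    fun t => ((hasDerivAt_potential_gap h c₀ t).sub (hasDerivAt_quadratic _ _ t)).add
      ((hasDerivAt_tailPrimitive h t).const_mul _)
  have hmono := le_of_hasDerivAt_nonneg h0.le hd fun t ht0 hts => by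
    rw [force_gap h ht0 (by linarith)]
    have := hatAvg_ge_three_halves h ht0.le (by linarith)
    nlinarith
  simp only [tailPrimitive_zero, add_zero] at hmono
  rw [potential_one_div h] at hmono
  have hT := tailPrimitive_le h h0.le h1
  have hs2 : 0 < q / 2 * s ^ 2 := by positivity
  have : 0 < M * (potential M α c₀ ((1 + s) / M) - potential M α c₀ 0) := by nlinarith
  linarith [pos_of_mul_pos_right this h.M_pos.le]

/-- The long side of the tent bounds the force below by an affine function, integrated here from 1.
The range stops at α - 3/2, where the lower bound 2 + δ(1/2 - s) for the averaged tent reaches zero.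
-/
theorem potential_gap_middle (h : Admissible M α) (c₀ : ℝ) {s : ℝ} (h1 : 1 ≤ s)
    (h2 : s ≤ α - 3 / 2) :
    (s - 1) * (1 / (M - 2) * (s + 1) / 2 + 1 / 2 - 2 / (α - 2) * s / 4)
      ≤ M * potential M α c₀ ((1 + s) / M) - M * potential M α c₀ ((1 + 1) / M) := by
  have hM := h.lt_M
  have hu := h.upper
  have hqM := one_div_mul_sub h
  set q := 1 / (M - 2)
  set δ := 2 / (α - 2) with hδ
  have hd : ∀ t, HasDerivAt (fun s => M * potential M α c₀ ((1 + s) / M)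
      - ((q / 2 - δ / 4) * s ^ 2 + (1 / 2 + δ / 4) * s))
      (force M α ((1 + t) / M) - (2 * (q / 2 - δ / 4) * t + (1 / 2 + δ / 4))) t :=
    fun t => (hasDerivAt_potential_gap h c₀ t).sub (hasDerivAt_quadratic _ _ t)
  have hmono := le_of_hasDerivAt_nonneg h1 hd fun t ht0 hts => by
    rw [force_gap h (by linarith) (by linarith), hatSumAvg_of_two_le h (by linarith)]
    have := hatAvg_ge_affine h ht0.le
    rw [← hδ] at this
    nlinarith
  nlinarith

/-- The tent is dropped; the linear attraction to the midpoint bounds the loss by a quadratic. -/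
theorem potential_gap_far (h : Admissible M α) (c₀ : ℝ) {a s : ℝ} (h1 : 1 ≤ a) (h2 : a ≤ s)
    (h3 : s ≤ M / 2 - 1) :
    -(1 / (M - 2) / 2 * (M / 2 - 1 - a) ^ 2)
      ≤ M * potential M α c₀ ((1 + s) / M) - M * potential M α c₀ ((1 + a) / M) := by
  have hq := one_div_M_sub_pos h
  set q := 1 / (M - 2)
  have hd : ∀ t, HasDerivAt (fun s => M * potential M α c₀ ((1 + s) / M)
      - (q / 2 * s ^ 2 + q * (1 - M / 2) * s))
      (force M α ((1 + t) / M) - (2 * (q / 2) * t + q * (1 - M / 2))) t :=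
    fun t => (hasDerivAt_potential_gap h c₀ t).sub (hasDerivAt_quadratic _ _ t)
  have hmono := le_of_hasDerivAt_nonneg h2 hd fun t ht0 hts => by
    rw [force_gap h (by linarith) (by linarith), hatSumAvg_of_two_le h (by linarith)]
    have := hatAvg_nonneg (M := M) (α := α) (M - 1 - t)
    linarith
  have := mul_nonneg hq.le (sq_nonneg (M / 2 - 1 - s))
  linarith

theorem potential_gap (h : Admissible M α) (c₀ : ℝ) {s : ℝ} (h0 : 0 < s) (h1 : s ≤ M / 2 - 1) :
    potential M α c₀ 0 < potential M α c₀ ((1 + s) / M) := by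
  rcases le_total s 1 with hs | hs
  · exact potential_gap_near h c₀ h0 hs
  have hnear := potential_gap_near h c₀ one_pos le_rfl
  have hM := h.lt_M
  have hα := h.lt_alpha
  have hl := h.lower
  have hq := one_div_M_sub_pos h
  have hqM := one_div_mul_sub h
  have hδ := h.slope_pos
  have hδ' := h.slope_lt
  have hδ2 := h.slope_mul
  have hmid := fun t => potential_gap_middle h c₀ (s := t)
  have hfar := potential_gap_far h c₀ (a := α - 3 / 2) (s := s) (by linarith)
  set q := 1 / (M - 2)
  set δ := 2 / (α - 2)
  have hqα : 1 / 3 ≤ q * (α - 1 / 2) := by nlinarith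
  suffices H : 0 ≤ M * potential M α c₀ ((1 + s) / M) - M * potential M α c₀ ((1 + 1) / M) by
    have : potential M α c₀ ((1 + 1) / M) ≤ potential M α c₀ ((1 + s) / M) :=
      le_of_mul_le_mul_left (by linarith) h.M_pos
    linarith
  rcases le_total s (α - 3 / 2) with hs2 | hs2
  -- The second factor is nonincreasing in s since q ≤ δ/2, and at s = α - 3/2 it is q(α - 1/2)/2 -
  -- δ/8 ≥ 1/6 - δ/8 > 0.
  · refine le_trans (mul_nonneg (by linarith) ?_) (hmid s hs hs2)
    have hqδ : q ≤ δ / 2 := by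
      have : 1 / (M - 2) ≤ 1 / (α - 2) := one_div_le_one_div_of_le (by linarith) (by
        linarith [h.upper])
      have e : δ / 2 = 1 / (α - 2) := by simp only [δ]; ring
      rw [e]
      exact this
    have := mul_nonneg (by linarith : 0 ≤ δ / 4 - q / 2) (by linarith : 0 ≤ α - 3 / 2 - s)
    nlinarith
  · have h3 := hmid (α - 3 / 2) (by linarith) le_rfl
    have h4 := hfar hs2 h1
    have e1 : (α - 3 / 2 - 1) * (q * (α - 3 / 2 + 1) / 2 + 1 / 2 - δ * (α - 3 / 2) / 4)
        = q * ((α - 3 / 2) ^ 2 - 1) / 2 - δ * (α - 2) / 8 + δ / 16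
          + (α - 5 / 2) * (1 / 2 - δ * (α - 2) / 4) := by ring
    rw [e1, hδ2] at h3
    -- Middle gain against far loss: by the lower bound on α the difference of squares is large
    -- enough to absorb the -1/4 from `h3`.
    have h5 : M - 2 ≤ 2 * ((α - 3 / 2) ^ 2 - 1 - (M / 2 - 1 - (α - 3 / 2)) ^ 2) := by nlinarith
    have h6 := mul_le_mul_of_nonneg_left h5 hq.le
    rw [hqM] at h6
    linarith

theorem potential_middle_gap (h : Admissible M α) (c₀ : ℝ) {x : ℝ} (h0 : 1 < M * x)
    (h1 : M * x < M - 1) : potential M α c₀ 0 < potential M α c₀ x := by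
  have hM := h.M_pos
  have key : ∀ y, 1 < M * y → M * y ≤ M / 2 → potential M α c₀ 0 < potential M α c₀ y := by
    intro y hy1 hy2
    have := potential_gap h c₀ (s := M * y - 1) (by linarith) (by linarith)
    rwa [add_sub_cancel, mul_div_cancel_left₀ _ hM.ne'] at this
  rcases le_total (M * x) (M / 2) with hx | hx
  · exact key x h0 hx
  · rw [← potential_reflect h c₀ x]
    apply key <;> linarith

/-- Up to 2 the term s/2 in the integrated force pays for the tail primitive and the quadratic term
gives strictness. Beyond 2 the tents are gone and the force is positive. -/
theorem potential_gt_one (h : Admissible M α) (c₀ : ℝ) {x : ℝ} (hx : 1 < x) :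
    potential M α c₀ 0 < potential M α c₀ x := by
  have hM := h.lt_M
  have hq := one_div_M_sub_pos h
  have h10 : potential M α c₀ 1 = potential M α c₀ 0 := by
    rw [← potential_reflect h c₀ 0, sub_zero]
  set p := 1 / (M - 2) * M with hp_def
  have hp : 0 < p := mul_pos hq h.M_pos
  have key : ∀ s, 0 < s → s ≤ 1 → potential M α c₀ 0 < potential M α c₀ (1 + s) := by
    intro s h0 h1
    have hd : ∀ t, HasDerivAt (fun s => potential M α c₀ (1 + s)
        - (p / 2 * s ^ 2 + 1 / 2 * s) + tailPrimitive M α s)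
        (force M α (1 + t) - (2 * (p / 2) * t + 1 / 2) + hatSumAvg M α (1 + t)) t :=
      fun t => (((hasDerivAt_potential h c₀ (1 + t)).comp_const_add 1 t).sub
        (hasDerivAt_quadratic _ _ t)).add (hasDerivAt_tailPrimitive h t)
    have hmono := le_of_hasDerivAt_nonneg h0.le hd fun t ht0 hts => by
      rw [force_outside h ht0, ← hp_def]
      linarith
    simp only [tailPrimitive_zero, add_zero] at hmono
    have hT := tailPrimitive_le h h0.le h1
    have hs2 : 0 < p / 2 * s ^ 2 := by positivity
    linarith
  rcases le_total x 2 with hx2 | hx2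
  · have := key (x - 1) (by linarith) (by linarith)
    rwa [add_sub_cancel] at this
  · have h2 := key 1 one_pos le_rfl
    have hmono := le_of_hasDerivAt_nonneg hx2 (hasDerivAt_potential h c₀) fun t ht0 hts => by
      rw [show t = 1 + (t - 1) by ring, force_outside h (by linarith),
        hatSumAvg_of_two_le h (by linarith), ← hp_def]
      nlinarith
    norm_num at h2
    linarith

theorem potential_outside (h : Admissible M α) (c₀ : ℝ) {x : ℝ} (hx : x ∉ Set.Icc (0 : ℝ) 1) :
    potential M α c₀ 0 < potential M α c₀ x := by
  rcases lt_or_ge 1 x with h1 | h1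
  · exact potential_gt_one h c₀ h1
  · have h0 : x < 0 := by
      by_contra! h0; exact hx ⟨h0, h1⟩
    rw [← potential_reflect h c₀ x]
    exact potential_gt_one h c₀ (by linarith)

/-- Unless x is outside [0,1] or in the middle gap, one expansion by M takes it off the previous
level and multiplies the excess by 2M. -/
theorem potential_off_level (h : Admissible M α) (c₀ : ℝ) (k : ℕ) {x : ℝ} (hx : x ∉ level M k) :
    potential M α c₀ 0 < potential M α c₀ x := by
  have hM := h.M_pos
  induction k generalizing x with
  | zero => rw [level_zero] at hx; exact potential_outside h c₀ hx
  | succ k ih =>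
    rw [mem_level_succ h, not_or] at hx
    by_cases hx01 : x ∈ Set.Icc (0 : ℝ) 1
    · have hM2 : 0 < 1 / M / 2 := by positivity
      rcases le_or_gt (M * x) 1 with h1 | h1
      · have h2 := potential_left h c₀ hx01.1 h1
        have h3 := mul_pos hM2 (sub_pos.2 (ih hx.1))
        linarith
      rcases lt_or_ge (M * x) (M - 1) with h2 | h2
      · exact potential_middle_gap h c₀ h1 h2
      · have h3 := potential_right h c₀ h2 hx01.2
        have h4 := mul_pos hM2 (sub_pos.2 (ih hx.2))
        linarith
    · exact potential_outside h c₀ hx01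

/-- Each of the k expansions that keep x in [0,1] contracts the excess by 1/(2M) ≤ 1/2; letting k
grow forces it to vanish on S. -/
theorem abs_potential_on_level (h : Admissible M α) (c₀ : ℝ) {B : ℝ}
    (hB : ∀ x ∈ Set.Icc (0 : ℝ) 1, |potential M α c₀ x - potential M α c₀ 0| ≤ B) (k : ℕ) {x : ℝ}
    (hx : x ∈ level M k) :
    |potential M α c₀ x - potential M α c₀ 0| ≤ (1 / 2) ^ k * B := by
  have hM := h.M_pos
  induction k generalizing x with
  | zero => rw [level_zero] at hx; simpa using hB x hx
  | succ k ih =>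
    have hx01 := level_subset_unit h _ hx
    have hM2 : 0 < 1 / M / 2 := by positivity
    have hM1 : 1 / M / 2 ≤ 1 / 2 := by
      have : 1 / M ≤ 1 := (div_le_one hM).2 (by linarith [h.lt_M])
      linarith
    have key : ∀ z, z ∈ level M k → potential M α c₀ x - potential M α c₀ 0
        = 1 / M / 2 * (potential M α c₀ z - potential M α c₀ 0) →
        |potential M α c₀ x - potential M α c₀ 0| ≤ (1 / 2) ^ (k + 1) * B := by
      intro z hz hzx
      rw [hzx, abs_mul, abs_of_pos hM2, pow_succ', mul_assoc]
      exact mul_le_mul hM1 (ih hz) (abs_nonneg _) (by norm_num)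
    rcases (mem_level_succ h).1 hx with h1 | h1
    · have := level_subset_unit h _ h1
      exact key _ h1 (potential_left h c₀ hx01.1 this.2)
    · have := level_subset_unit h _ h1
      exact key _ h1 (potential_right h c₀ (by linarith [this.1]) hx01.2)

theorem potential_on_cantorSet (h : Admissible M α) (c₀ : ℝ) {x : ℝ} (hx : x ∈ cantorSet M) :
    potential M α c₀ x = potential M α c₀ 0 := by
  have hc : Continuous fun x => potential M α c₀ x - potential M α c₀ 0 :=
    (continuous_iff_continuousAt.2 fun x => (hasDerivAt_potential h c₀ x).continuousAt).sub
      continuous_const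
  obtain ⟨B, hB⟩ := isCompact_Icc.exists_bound_of_continuousOn (s := Set.Icc (0 : ℝ) 1)
    hc.continuousOn
  have h1 : |potential M α c₀ x - potential M α c₀ 0| ≤ 0 * B :=
    ge_of_tendsto' ((tendsto_pow_atTop_nhds_zero_of_lt_one (by norm_num)
      (by norm_num : (1 / 2 : ℝ) < 1)).mul_const B) fun k =>
        abs_potential_on_level h c₀ hB k (Set.mem_iInter.1 hx k)
  rw [zero_mul, abs_nonpos_iff, sub_eq_zero] at h1
  exact h1

theorem potential_off_cantorSet (h : Admissible M α) (c₀ : ℝ) {x : ℝ} (hx : x ∉ cantorSet M) :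
    potential M α c₀ 0 < potential M α c₀ x := by
  obtain ⟨k, hk⟩ := not_forall.1 (fun hx' => hx (Set.mem_iInter.2 hx'))
  exact potential_off_level h c₀ k hk

/-! ### Consequences of minimality on the Cantor set. -/

theorem potential_zero_le (h : Admissible M α) (c₀ x : ℝ) :
    potential M α c₀ 0 ≤ potential M α c₀ x := by
  by_cases hx : x ∈ cantorSet M
  · exact (potential_on_cantorSet h c₀ hx).ge
  · exact (potential_off_cantorSet h c₀ hx).le

/-- Points of S are global minima of a differentiable function; no computation of the force is
needed. -/
theorem force_on_cantorSet (h : Admissible M α) {x : ℝ} (hx : x ∈ cantorSet M) :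
    force M α x = 0 := by
  have hmin : IsLocalMin (potential M α 0) x := Eventually.of_forall fun y => by
    rw [potential_on_cantorSet h 0 hx]
    exact potential_zero_le h 0 y
  exact hmin.hasDerivAt_eq_zero (hasDerivAt_potential h 0 x)

theorem ae_mem_cantorSet (h : Admissible M α) : ∀ᵐ x ∂(cantorMeasure M), x ∈ cantorSet M := by
  rw [← support_cantorMeasure h]
  exact Measure.support_mem_ae

theorem energy_eq (h : Admissible M α) (c₀ : ℝ) :
    2 * energy (limitPotential M α c₀) (cantorMeasure M) = potential M α c₀ 0 := by
  have := isProbabilityMeasure_cantorMeasure h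
  have h1 : ∫ x, ∫ y, limitPotential M α c₀ (x - y) ∂(cantorMeasure M) ∂(cantorMeasure M)
      = ∫ _, potential M α c₀ 0 ∂(cantorMeasure M) := by
    refine integral_congr_ae ?_
    filter_upwards [ae_mem_cantorSet h] with x hx using potential_on_cantorSet h c₀ hx
  rw [energy, h1, integral_const, probReal_univ, one_smul]
  ring

theorem isSteadyState_cantorMeasure (h : Admissible M α) (c₀ : ℝ) :
    IsSteadyState (limitPotential M α c₀) (cantorMeasure M) := by
  filter_upwards [ae_mem_cantorSet h] with x hx
  refine fun ε hε => Eventually.of_forall fun y => ?_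
  have h1 : conv (limitPotential M α c₀) (cantorMeasure M) x
      ≤ conv (limitPotential M α c₀) (cantorMeasure M) y :=
    (potential_on_cantorSet h c₀ hx).trans_le (potential_zero_le h c₀ y)
  linarith [mul_nonneg hε.le (abs_nonneg (y - x))]

theorem d2MinimizerCondition_cantorMeasure (h : Admissible M α) (c₀ : ℝ) :
    D2MinimizerCondition (limitPotential M α c₀) (cantorMeasure M) := by
  rw [D2MinimizerCondition, energy_eq h]
  refine ⟨?_, ae_of_all _ fun x => potential_zero_le h c₀ x⟩
  filter_upwards [ae_mem_cantorSet h] with x hx using potential_on_cantorSet h c₀ hx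

end

end CantorSteady

theorem mainTheorem12 (M α : ℝ) (hα₁ : 1 / 3 * (M + 2) < α) (hα₂ : α ≤ 2 / 5 * (M - 10))
    (c₀ : ℝ) :
    -- the pointwise limit `W_∞'` exists, and `W_∞` is continuous with this derivative off `0`
    (∀ x : ℝ, x ≠ 0 → Tendsto (fun k : ℕ => CantorSteady.derivPotential M α k x) atTop
        (𝓝 (CantorSteady.limitDeriv M α x))) ∧
    Continuous (CantorSteady.limitPotential M α c₀) ∧
    (∀ x : ℝ, x ≠ 0 → HasDerivAt (CantorSteady.limitPotential M α c₀)
        (CantorSteady.limitDeriv M α x) x) ∧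
    -- the weak limit `ρ_∞` of the `ρ_k` exists, and its support is the Cantor set
    ∃ ρ : Measure ℝ, IsProbabilityMeasure ρ ∧
      CantorSteady.WeakLimit (CantorSteady.rhoMeasure M) ρ ∧
      ρ.support = CantorSteady.cantorSet M ∧
      -- `W_∞ * ρ_∞` is well defined, constant on the support and larger off the support
      (∀ x : ℝ, Integrable (fun y => CantorSteady.limitPotential M α c₀ (x - y)) ρ) ∧
      (∃ c : ℝ,
        (∀ x ∈ ρ.support, CantorSteady.conv (CantorSteady.limitPotential M α c₀) ρ x = c) ∧
        (∀ x ∉ ρ.support, c < CantorSteady.conv (CantorSteady.limitPotential M α c₀) ρ x)) ∧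
      -- regularity
      (∃ γ : ℝ≥0, 0 < γ ∧ γ ≤ 1 ∧
        CantorSteady.C1HolderLoc γ (CantorSteady.conv (CantorSteady.limitPotential M α c₀) ρ)) ∧
      -- `W_∞' * ρ_∞` is defined pointwise, is the derivative of `W_∞ * ρ_∞`, and vanishes on the
      -- support
      (∀ x : ℝ, Integrable (fun y => CantorSteady.limitDeriv M α (x - y)) ρ ∧
        HasDerivAt (CantorSteady.conv (CantorSteady.limitPotential M α c₀) ρ)
          (CantorSteady.conv (CantorSteady.limitDeriv M α) ρ x) x) ∧
      (∀ x ∈ ρ.support, CantorSteady.conv (CantorSteady.limitDeriv M α) ρ x = 0) ∧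
      CantorSteady.IsSteadyState (CantorSteady.limitPotential M α c₀) ρ ∧
      CantorSteady.D2MinimizerCondition (CantorSteady.limitPotential M α c₀) ρ := by
  have h : CantorSteady.Admissible M α := ⟨hα₁, hα₂⟩
  refine ⟨fun x _ => ?_, CantorSteady.continuous_limitPotential h c₀, fun x hx => ?_,
    CantorSteady.cantorMeasure M, CantorSteady.isProbabilityMeasure_cantorMeasure h,
    CantorSteady.weakLimit_rhoMeasure h, CantorSteady.support_cantorMeasure h,
    CantorSteady.integrable_limitPotential h c₀, ⟨CantorSteady.potential M α c₀ 0, ?_, ?_⟩,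
    ⟨(CantorSteady.holderExp M).toNNReal, Real.toNNReal_pos.2 (CantorSteady.holderExp_pos h),
      Real.toNNReal_le_one.2 (CantorSteady.holderExp_le_one h),
      CantorSteady.c1HolderLoc_conv h c₀⟩, fun x => ?_, fun x hx => ?_,
    CantorSteady.isSteadyState_cantorMeasure h c₀,
    CantorSteady.d2MinimizerCondition_cantorMeasure h c₀⟩
  · rw [CantorSteady.limitDeriv_eq h]
    exact CantorSteady.tendsto_derivPotential h x
  · rw [CantorSteady.limitDeriv_eq h]
    exact CantorSteady.hasDerivAt_limitPotential h c₀ hx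
  · intro x hx
    rw [CantorSteady.support_cantorMeasure h] at hx
    exact CantorSteady.potential_on_cantorSet h c₀ hx
  · intro x hx
    rw [CantorSteady.support_cantorMeasure h] at hx
    exact CantorSteady.potential_off_cantorSet h c₀ hx
  · rw [CantorSteady.limitDeriv_eq h]
    exact CantorSteady.integrable_kernel_and_hasDerivAt_conv h c₀ x
  · rw [CantorSteady.limitDeriv_eq h]
    rw [CantorSteady.support_cantorMeasure h] at hx
    exact CantorSteady.force_on_cantorSet h hx
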